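/- **Setting.** Let $X$ be a finite set, let $\mathbb H_k,\mathbb H_{\tilde k}$ be reproducing kernel Hilbert spaces of real functions on $X$ with kernels $k,\tilde k$ satisfying $k(x,x)\le 1$, $\tilde k(x,x)\le 1$, and let $T\ge 1$ be the horizon. At each time $t=1,\dots,T$ there are an unknown reward function $f_t\in\mathbb H_k$ with $\|f_t\|_{\mathbb H_k}\le B$ and an unknown constraint function $g_t\in\mathbb H_{\tilde k}$ with $\|g_t\|_{\mathbb H_{\tilde k}}\le G$ ($B,G>0$). For a probability vector $\pi$ on $X$ write $\mathbb E_\pi h=\sum_{x}\pi(x)h(x)$. Assume: * (Slater) for some $\tau>0$ and every $t\le T$ there is a policy $\pi^o_t$ on $X$ with $\mathbb E_{\pi^o_t}g_t\le-\tau$; * (variation budgets) $\sum_{t=1}^{T-1}\|f_{t+1}-f_t\|_{\mathbb H_k}\le B_f$ and $\sum_{t=1}^{T-1}\|g_{t+1}-g_t\|_{\mathbb H_{\tilde k}}\le B_g$; put $B_\Delta=\max\{B_f,B_g\}$ and assume $B_\Delta\ge b_0$ for a constant $b_0>0$; * (noise) playing $x_t$ reveals $r_t=f_t(x_t)+n_t$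 and $c_t=g_t(x_t)+\epsilon_t$. There is a filtration $(\mathcal F_t)_{t\ge0}$ such that $x_t$ is $\mathcal F_{t-1}$-measurable, $n_t,\epsilon_t$ are $\mathcal F_t$-measurable and, conditionally on $\mathcal F_{t-1}$, each is $R$-sub-Gaussian, $R\ge 0$ (for instance independent Gaussian noise). For $\lambda>0$ let $\gamma_n=\max_{(x_1,\dots,x_n)\in X^n}\frac12\log\det\big(I+\lambda^{-1}[k(x_i,x_j)]_{i,j}\big)$, define $\tilde\gamma_n$ likewise from $\tilde k$, and put $\hat\gamma_T=\max\{\gamma_T,\tilde\gamma_T\}$. **Algorithm.** The inputs are $k,\tilde k,\lambda,R,B,G,T$, a confidence parameter $\delta\in(0,1)$, $\rho\ge 4B/\tau$, and the restart period $W=\hat\gamma_T^{1/4}T^{1/2}$, rounded up or down to a positive integer; the budgets $B_f,B_g$ are not used. Put $\eta=\rho/(G\sqrt T)$ and $\phi_1=0$. At time $t$ let $t_0\le t$ be the last time with $t_0\equiv 1\pmod W$. Let $\mu_{t-1},\sigma^2_{t-1}$ be the Gaussian process posterior mean and variance (kernel $k$, regularization $\lambda$) from the data $(x_s,r_s)$,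 $t_0\le s\le t-1$, that is, $\mu(x)=k(x)^{T}(K+\lambda I)^{-1}r$ and $\sigma^2(x)=k(x,x)-k(x)^{T}(K+\lambda I)^{-1}k(x)$ with $K=[k(x_s,x_{s'})]$ and $k(x)=[k(x_s,x)]$, and let $\tilde\mu_{t-1},\tilde\sigma^2_{t-1}$ be their analogues from $\tilde k$ and $(x_s,c_s)$. With $$\beta_{t-1}=B+\tfrac{R}{\sqrt\lambda}\sqrt{2\log\tfrac1\delta+2\gamma_{t-t_0}},\qquad \tilde\beta_{t-1}=G+\tfrac{R}{\sqrt\lambda}\sqrt{2\log\tfrac1\delta+2\tilde\gamma_{t-t_0}},$$ let $\hat f_t$ be $\mu_{t-1}+\beta_{t-1}\sigma_{t-1}$ projected onto $[-B,B]$ and $\hat g_t$ be $\tilde\mu_{t-1}-\tilde\beta_{t-1}\tilde\sigma_{t-1}$ projected onto $[-G,G]$. Play $x_t\in\arg\max_{x\in X}\{\hat f_t(x)-\phi_t\hat g_t(x)\}$ and set $\phi_{t+1}=\mathrm{Proj}_{[0,\rho]}[\phi_t+\eta\,\hat g_t(x_t)]$ (the dual variable is not reset at restarts). Let $\pi_t^*$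 maximize $\mathbb E_\pi f_t$ over the policies $\pi$ with $\mathbb E_\pi g_t\le 0$, and put $$R(T)=\sum_{t=1}^T\mathbb E_{\pi^*_t}f_t-\sum_{t=1}^T f_t(x_t),\qquad V(T)=\Big[\sum_{t=1}^T g_t(x_t)\Big]_+ .$$ **Theorem.** For all $B,G,R,\lambda,\tau,b_0$ as above and every $\delta_0>0$ there is a constant $C$, depending on these seven numbers only, such that for every instance as above, every $T\ge1$, every $\rho\ge 4B/\tau$ and every $\delta\in[\delta_0/T,1)$, with probability at least $1-2\lceil T/W\rceil\delta$ both $$R(T)\le C\left(\rho G\sqrt T+\rho\,\hat\gamma_T^{7/8}B_\Delta T^{3/4}\right)\quad\text{and}\quad V(T)\le C\left(\Big(1+\frac1\rho\Big)\hat\gamma_T^{7/8}B_\Delta T^{3/4}+G\sqrt T\right)$$ hold. In particular, for $\varepsilon\in(0,1)$ and $\delta=\varepsilon/(2\lceil T/W\rceil)$ both bounds hold with probability at least $1-\varepsilon$, with $C$ not depending on $T$. -/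

import Mathlib

open MeasureTheory ProbabilityTheory
open scoped Matrix

noncomputable section

namespace RestartGPUCB

/-- Projection of a real number onto the interval `[lo, hi]` (for `lo ≤ hi`). -/
def clamp (lo hi v : ℝ) : ℝ := max lo (min hi v)

/-- The real-valued kernel `k(x, y)` of a reproducing kernel Hilbert space `H` of real functions
on `X`. -/
def scalarKernel {X : Type*} (H : Type*) [NormedAddCommGroup H] [InnerProductSpace ℝ H]
    [CompleteSpace H] [RKHS ℝ H X ℝ] (x y : X) : ℝ :=
  RKHS.kernel H x y 1

/-! ### Gaussian process surrogate -/

/-- The kernel matrix of a finite sequence of sampling points (repetitions allowed). -/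
def gram {X : Type*} (k : X → X → ℝ) {n : ℕ} (xs : Fin n → X) : Matrix (Fin n) (Fin n) ℝ :=
  Matrix.of fun i j => k (xs i) (xs j)

/-- The vector `[k(x₁, z), …, k(xₙ, z)]`. -/
def kvec {X : Type*} (k : X → X → ℝ) {n : ℕ} (xs : Fin n → X) (z : X) : Fin n → ℝ :=
  fun i => k (xs i) z

/-- Posterior mean at `z` given observations `y` at the points `xs`. -/
def postMean {X : Type*} (k : X → X → ℝ) (lam : ℝ) {n : ℕ} (xs : Fin n → X) (y : Fin n → ℝ)
    (z : X) : ℝ :=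
  kvec k xs z ⬝ᵥ ((gram k xs + lam • (1 : Matrix (Fin n) (Fin n) ℝ))⁻¹ *ᵥ y)

/-- Posterior variance at `z` given observations at the points `xs`. -/
def postVar {X : Type*} (k : X → X → ℝ) (lam : ℝ) {n : ℕ} (xs : Fin n → X) (z : X) : ℝ :=
  k z z - kvec k xs z ⬝ᵥ ((gram k xs + lam • (1 : Matrix (Fin n) (Fin n) ℝ))⁻¹ *ᵥ kvec k xs z)

/-- Maximum information gain of `n` samples: the largest value of `½ log det (I + λ⁻¹ K_A)` over
all sequences `A` of `n` points of `X`. -/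
def maxInfoGain {X : Type*} (k : X → X → ℝ) (lam : ℝ) (n : ℕ) : ℝ :=
  ⨆ xs : Fin n → X,
    1 / 2 * Real.log ((1 : Matrix (Fin n) (Fin n) ℝ) + lam⁻¹ • gram k xs).det

/-! ### The algorithm -/

/-- Inputs of the algorithm: regularization `lam`, confidence parameter `delta`, noise level `R`,
norm bounds `B` (reward) and `G` (constraint), cap `rho` of the dual variable, horizon `T` and
restart period `W`. No variation budget is among them. -/
structure Params where
  lam : ℝ
  delta : ℝ
  R : ℝ
  B : ℝ
  G : ℝ
  rho : ℝ
  T : ℕ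
  W : ℕ

/-- Dual step size `η = ρ / (G √T)`. -/
def Params.eta (p : Params) : ℝ := p.rho / (p.G * Real.sqrt p.T)

/-- The last restart time `t₀ ≤ t`: restarts take place at the times `t ≥ 1` with
`t ≡ 1 (mod W)`. -/
def blockStart (W t : ℕ) : ℕ := (t - 1) / W * W + 1

/-- The entries of a sequence at the times `t₀, …, t - 1`, which are the data used at time `t`. -/
def window {α : Type*} (W t : ℕ) (u : ℕ → α) : Fin (t - blockStart W t) → α :=
  fun i => u (blockStart W t + i)

/-- Confidence width after `n` samples, for a function with norm bound `b`. -/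
def confWidth {X : Type*} (k : X → X → ℝ) (p : Params) (b : ℝ) (n : ℕ) : ℝ :=
  b + 1 / Real.sqrt p.lam * p.R *
    Real.sqrt (2 * Real.log (1 / p.delta) + 2 * maxInfoGain k p.lam n)

/-- Optimistic estimate `f̂ₜ` of the reward function at time `t`, from queries `x` and
reward observations `r`. -/
def fHat {X : Type*} (k : X → X → ℝ) (p : Params) (x : ℕ → X) (r : ℕ → ℝ) (t : ℕ) (z : X) : ℝ :=
  clamp (-p.B) p.B
    (postMean k p.lam (window p.W t x) (window p.W t r) z
      + confWidth k p p.B (t - blockStart p.W t)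
        * Real.sqrt (postVar k p.lam (window p.W t x) z))

/-- Optimistic estimate `ĝₜ` of the constraint function at time `t`, from queries `x` and
constraint observations `c`. -/
def gHat {X : Type*} (k' : X → X → ℝ) (p : Params) (x : ℕ → X) (c : ℕ → ℝ) (t : ℕ) (z : X) : ℝ :=
  clamp (-p.G) p.G
    (postMean k' p.lam (window p.W t x) (window p.W t c) z
      - confWidth k' p p.G (t - blockStart p.W t)
        * Real.sqrt (postVar k' p.lam (window p.W t x) z))

/-- `(x, φ)` is a run of the restarted GP-UCB algorithm with constraints over the horizon `p.T`,
on the observation sequences `r` and `c`: the dual variable starts at `0` and is not reset at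
restarts, every query maximizes the acquisition function (ties are broken in any way), and the
dual variable follows projected gradient steps. -/
structure IsRun {X : Type*} (k k' : X → X → ℝ) (p : Params) (x : ℕ → X) (r c φ : ℕ → ℝ) :
    Prop where
  dual_init : φ 1 = 0
  select : ∀ t ∈ Finset.Icc 1 p.T, ∀ z : X,
    fHat k p x r t z - φ t * gHat k' p x c t z
      ≤ fHat k p x r t (x t) - φ t * gHat k' p x c t (x t)
  dual_step : ∀ t ∈ Finset.Icc 1 p.T,
    φ (t + 1) = clamp 0 p.rho (φ t + p.eta * gHat k' p x c t (x t))

/-! ### Noise, policies, regret and violation -/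

/-- `ξ` is conditionally `R`-sub-Gaussian given the σ-algebra `m`. -/
def CondSubGaussian {Ω : Type*} {mΩ : MeasurableSpace Ω} (μ : Measure Ω) (m : MeasurableSpace Ω)
    (R : ℝ) (ξ : Ω → ℝ) : Prop :=
  ∀ s : ℝ, Integrable (fun ω => Real.exp (s * ξ ω)) μ ∧
    μ[fun ω => Real.exp (s * ξ ω) | m] ≤ᵐ[μ] fun _ => Real.exp (s ^ 2 * R ^ 2 / 2)

/-- The expectation of `h` under the policy `π` (a vector of probabilities on `X`). -/
def policyMean {X : Type*} [Fintype X] (π h : X → ℝ) : ℝ := ∑ x, π x * h x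

/-- `π` is a best policy for the reward function `f` subject to the constraint function `g`. -/
def IsBestPolicy {X : Type*} [Fintype X] (f g π : X → ℝ) : Prop :=
  IsMaxOn (fun π' => policyMean π' f) {π' | π' ∈ stdSimplex ℝ X ∧ policyMean π' g ≤ 0} π ∧
    π ∈ stdSimplex ℝ X ∧ policyMean π g ≤ 0

/-- Dynamic regret of the queries `x` against the policies `πs`. -/
def regret {X : Type*} [Fintype X] (f : ℕ → X → ℝ) (πs : ℕ → X → ℝ) (x : ℕ → X) (T : ℕ) : ℝ :=
  ∑ t ∈ Finset.Icc 1 T, policyMean (πs t) (f t) - ∑ t ∈ Finset.Icc 1 T, f t (x t)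

/-- Cumulative constraint violation of the queries `x`. -/
def violation {X : Type*} (g : ℕ → X → ℝ) (x : ℕ → X) (T : ℕ) : ℝ :=
  max (∑ t ∈ Finset.Icc 1 T, g t (x t)) 0

end RestartGPUCB

end

/-!
The two bounds hold on the event that the noise is controlled: within every block between two
restarts, the energy `nᵀ K (K + λ I)⁻¹ n` of the noise stays below
`R² (2 log (1/δ) + log det (I + λ⁻¹ K))`.

*Probability.* Bordering the kernel matrix by one row shows that the energy and the determinant
change in one step only through the posterior mean `m` of the noise and the posterior variance `σ²`
at the new query (`infoDet_succ`, `noiseEnergy_succ`). Hence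
`det (I + λ⁻¹ K)^(-1/2) exp (energy / (2 R²))` is a nonnegative supermartingale: a one-dimensional
Gaussian mixture linearizes the square of the new noise term, and the Gaussian integral left over by
the sub-Gaussian bound cancels the change of the determinant (`lintegral_mul_selfNormalized_le`).
Ville's inequality then gives a failure probability `δ` for each of the `⌈T/W⌉` blocks and each of
the two noise sequences.

*Confidence bounds.* The error of the posterior mean splits into the error of noiseless regularized
interpolation, at most `‖h‖ σ`; the noise, at most `σ √(energy / λ)` by Cauchy–Schwarz in `H × ℝⁿ`;
and the drift of the unknown function since the restart, at most `√(W/λ)` times its variation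
(`abs_sub_postMean_window_le`). Thus `f̂` and `ĝ` are optimistic up to the drift.

*Regret.* Optimism and the choice of `x t` bound the regret of one step by `-φ t ĝ t (x t)` plus
widths and drifts, and the projected steps of the dual variable make these terms telescope to
`ρ G √T / 2` (`OptimisticRun.regret_le`).

*Violation.* Let `T ≥ 4`. The sum of `η ĝ t (x t)` is at most `ρ` plus what the projection onto
`[0, ρ]` cuts off at the top. A step that is cut off starts at `φ t ≥ ρ / 2 ≥ 2 B / τ`; there the
Slater policy shows that the maximizer of the Lagrangian has `ĝ t (x t)` at most the drift, so
that the projection cuts off at most `η` times the drift (`OptimisticRun.dual_add_le`). No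
comparison of optimal dual variables at different times is needed.

*Rates.* A variation term is felt at fewer than `W` later times, which gives `W^(3/2) B_Δ` for the
drifts, and the chain rule for the information gives `√(T · (T/W) · γ)` for the sum of the posterior
standard deviations. The Slater condition makes some diagonal entry of the constraint kernel at
least `(τ/G)²`; therefore `γ` is bounded below and grows at least like `log T`, which dominates
`log (1/δ)` and lets every term be absorbed into `γ^(7/8) T^(3/4)`.
-/

namespace RestartGPUCB

/-! ### Kernel interpolation in a reproducing kernel Hilbert space -/

section Posterior

variable {X : Type*} {H : Type*} [NormedAddCommGroup H] [InnerProductSpace ℝ H]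
  [CompleteSpace H] [RKHS ℝ H X ℝ]

theorem scalarKernel_eq_inner (x y : X) :
    scalarKernel H x y = inner ℝ (RKHS.kerFun H x (1 : ℝ)) (RKHS.kerFun H y (1 : ℝ)) := by
  rw [RKHS.kerFun_inner, RKHS.kerFun_apply]
  simp [scalarKernel]

theorem scalarKernel_comm (x y : X) : scalarKernel H x y = scalarKernel H y x := by
  rw [scalarKernel_eq_inner, scalarKernel_eq_inner, real_inner_comm]

theorem scalarKernel_self (x : X) : scalarKernel H x x = ‖RKHS.kerFun H x (1 : ℝ)‖ ^ 2 := by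
  rw [scalarKernel_eq_inner, real_inner_self_eq_norm_sq]

theorem inner_kerFun_one (h : H) (x : X) : inner ℝ h (RKHS.kerFun H x (1 : ℝ)) = h x := by
  rw [RKHS.inner_kerFun]; simp

theorem sq_apply_le (h : H) (x : X) : (h x) ^ 2 ≤ ‖h‖ ^ 2 * scalarKernel H x x := by
  rw [← inner_kerFun_one, scalarKernel_self, ← mul_pow]
  exact sq_le_sq.2 (by rw [abs_mul, abs_norm, abs_norm]; exact abs_real_inner_le_norm _ _)

theorem abs_apply_le (h : H) (x : X) (hk : scalarKernel H x x ≤ 1) : |h x| ≤ ‖h‖ := by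
  have := sq_apply_le h x
  exact abs_le_of_sq_le_sq (by nlinarith [sq_nonneg ‖h‖]) (norm_nonneg _)

variable {n : ℕ}

theorem norm_sum_kerFun_sq (xs : Fin n → X) (u : Fin n → ℝ) :
    ‖∑ i, u i • RKHS.kerFun H (xs i) (1 : ℝ)‖ ^ 2 = u ⬝ᵥ (gram (scalarKernel H) xs *ᵥ u) := by
  rw [← real_inner_self_eq_norm_sq, sum_inner]
  simp only [dotProduct, Matrix.mulVec, gram, Matrix.of_apply, inner_sum, inner_smul_left,
    inner_smul_right, scalarKernel_eq_inner, Finset.mul_sum]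
  refine Finset.sum_congr rfl fun i _ => Finset.sum_congr rfl fun j _ => ?_
  simp; ring

theorem gram_isHermitian (xs : Fin n → X) : (gram (scalarKernel H) xs).IsHermitian := by
  ext i j
  simp [gram, scalarKernel_comm (H := H) (xs i) (xs j)]

theorem gram_posSemidef (xs : Fin n → X) : (gram (scalarKernel H) xs).PosSemidef :=
  .of_dotProduct_mulVec_nonneg (gram_isHermitian xs) fun u => by
    rw [star_trivial, ← norm_sum_kerFun_sq]; positivity

/-- The regularized kernel matrix `K + λ I`. -/
noncomputable def regGram (k : X → X → ℝ) (lam : ℝ) (xs : Fin n → X) : Matrix (Fin n) (Fin n) ℝ :=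
  gram k xs + lam • (1 : Matrix (Fin n) (Fin n) ℝ)

theorem regGram_posDef {lam : ℝ} (hlam : 0 < lam) (xs : Fin n → X) :
    (regGram (scalarKernel H) lam xs).PosDef :=
  Matrix.PosDef.posSemidef_add (gram_posSemidef xs) (Matrix.PosDef.one.smul hlam)

theorem regGram_isUnit_det {lam : ℝ} (hlam : 0 < lam) (xs : Fin n → X) :
    IsUnit (regGram (scalarKernel H) lam xs).det :=
  (regGram_posDef hlam xs).det_pos.ne'.isUnit

theorem regGram_mulVec_inv {lam : ℝ} (hlam : 0 < lam) (xs : Fin n → X) (y : Fin n → ℝ) :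
    regGram (scalarKernel H) lam xs *ᵥ ((regGram (scalarKernel H) lam xs)⁻¹ *ᵥ y) = y := by
  rw [Matrix.mulVec_mulVec, Matrix.mul_nonsing_inv _ (regGram_isUnit_det hlam xs),
    Matrix.one_mulVec]

theorem regGram_inv_isHermitian (lam : ℝ) (xs : Fin n → X) :
    ((regGram (scalarKernel H) lam xs)⁻¹).IsHermitian := by
  refine Matrix.IsHermitian.inv ((gram_isHermitian xs).add ?_)
  ext i j
  simp [Matrix.one_apply, eq_comm]

theorem dotProduct_self_nonneg (u : Fin n → ℝ) : 0 ≤ u ⬝ᵥ u :=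
  Finset.sum_nonneg fun i _ => mul_self_nonneg (u i)

theorem dotProduct_mulVec_comm {A : Matrix (Fin n) (Fin n) ℝ} (hA : A.IsHermitian)
    (u v : Fin n → ℝ) : u ⬝ᵥ (A *ᵥ v) = v ⬝ᵥ (A *ᵥ u) := by
  have : Aᵀ = A := by rwa [Matrix.IsHermitian, Matrix.conjTranspose_eq_transpose_of_trivial] at hA
  rw [Matrix.dotProduct_mulVec, ← Matrix.mulVec_transpose, this, dotProduct_comm]

/-- The weights `w = (K + λ I)⁻¹ k(z)` with which the observations enter the posterior mean. -/
noncomputable def postWeight (k : X → X → ℝ) (lam : ℝ) (xs : Fin n → X) (z : X) : Fin n → ℝ :=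
  (regGram k lam xs)⁻¹ *ᵥ kvec k xs z

theorem postMean_eq_dotProduct (lam : ℝ) (xs : Fin n → X) (y : Fin n → ℝ) (z : X) :
    postMean (scalarKernel H) lam xs y z = postWeight (scalarKernel H) lam xs z ⬝ᵥ y := by
  rw [postMean, postWeight, dotProduct_comm _ y,
    ← dotProduct_mulVec_comm (regGram_inv_isHermitian lam xs)]
  rfl

theorem postMean_add (k : X → X → ℝ) (lam : ℝ) (xs : Fin n → X) (y y' : Fin n → ℝ) (z : X) :
    postMean k lam xs (y + y') z = postMean k lam xs y z + postMean k lam xs y' z := by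
  simp [postMean, Matrix.mulVec_add]

/-- The residual of the representer of evaluation at `z` after regularized interpolation. -/
noncomputable def residual (H : Type*) [NormedAddCommGroup H] [InnerProductSpace ℝ H]
    [CompleteSpace H] [RKHS ℝ H X ℝ] (lam : ℝ) (xs : Fin n → X) (z : X) : H :=
  RKHS.kerFun H z (1 : ℝ) -
    ∑ i, postWeight (scalarKernel H) lam xs z i • RKHS.kerFun H (xs i) (1 : ℝ)

theorem inner_residual (lam : ℝ) (xs : Fin n → X) (z : X) (h : H) :
    inner ℝ h (residual H lam xs z) =
      h z - postWeight (scalarKernel H) lam xs z ⬝ᵥ (fun i => h (xs i)) := by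
  simp [residual, inner_sub_right, inner_sum, inner_smul_right, dotProduct]

/-- The posterior variance is the optimal value of the regularized interpolation problem
`min_w ‖k(z, ·) - ∑ᵢ wᵢ k(xᵢ, ·)‖² + λ |w|²`. -/
theorem norm_residual_sq_add {lam : ℝ} (hlam : 0 < lam) (xs : Fin n → X) (z : X) :
    ‖residual H lam xs z‖ ^ 2 + lam * (postWeight (scalarKernel H) lam xs z ⬝ᵥ
      postWeight (scalarKernel H) lam xs z) = postVar (scalarKernel H) lam xs z := by
  set w := postWeight (scalarKernel H) lam xs z with hw
  have h1 : regGram (scalarKernel H) lam xs *ᵥ w = kvec (scalarKernel H) xs z :=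
    regGram_mulVec_inv hlam xs _
  have h2 : w ⬝ᵥ (gram (scalarKernel H) xs *ᵥ w) + lam * (w ⬝ᵥ w) =
      w ⬝ᵥ kvec (scalarKernel H) xs z := by
    rw [← h1, regGram, Matrix.add_mulVec, dotProduct_add, Matrix.smul_mulVec, Matrix.one_mulVec,
      dotProduct_smul, smul_eq_mul]
  have h3 : postVar (scalarKernel H) lam xs z =
      scalarKernel H z z - w ⬝ᵥ kvec (scalarKernel H) xs z := by
    rw [postVar, dotProduct_comm w]; rfl
  have h4 : inner ℝ (RKHS.kerFun H z (1 : ℝ))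
      (∑ i, w i • RKHS.kerFun H (xs i) (1 : ℝ)) = w ⬝ᵥ kvec (scalarKernel H) xs z := by
    rw [inner_sum]
    refine Finset.sum_congr rfl fun i _ => ?_
    rw [inner_smul_right, ← scalarKernel_eq_inner, scalarKernel_comm]; rfl
  have h5 : ‖residual H lam xs z‖ ^ 2 = scalarKernel H z z
      - 2 * (w ⬝ᵥ kvec (scalarKernel H) xs z) + w ⬝ᵥ (gram (scalarKernel H) xs *ᵥ w) := by
    rw [residual, norm_sub_sq_real, ← scalarKernel_self, ← hw, h4, norm_sum_kerFun_sq]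
  rw [h5, h3]; linarith

theorem postWeight_sq_le {lam : ℝ} (hlam : 0 < lam) (xs : Fin n → X) (z : X) :
    lam * (postWeight (scalarKernel H) lam xs z ⬝ᵥ postWeight (scalarKernel H) lam xs z) ≤
      postVar (scalarKernel H) lam xs z := by
  rw [← norm_residual_sq_add hlam]; nlinarith [sq_nonneg ‖residual H lam xs z‖]

theorem postVar_nonneg {lam : ℝ} (hlam : 0 < lam) (xs : Fin n → X) (z : X) :
    0 ≤ postVar (scalarKernel H) lam xs z :=
  (mul_nonneg hlam.le (dotProduct_self_nonneg _)).trans (postWeight_sq_le hlam xs z)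

theorem postVar_le {lam : ℝ} (hlam : 0 < lam) (xs : Fin n → X) (z : X) :
    postVar (scalarKernel H) lam xs z ≤ scalarKernel H z z := by
  have := (regGram_posDef (H := H) hlam xs).inv.posSemidef.dotProduct_mulVec_nonneg
    (kvec (scalarKernel H) xs z)
  rw [star_trivial] at this
  have h : postVar (scalarKernel H) lam xs z = scalarKernel H z z - kvec (scalarKernel H) xs z ⬝ᵥ
    ((regGram (scalarKernel H) lam xs)⁻¹ *ᵥ kvec (scalarKernel H) xs z) := rfl
  linarith

/-- Without noise, the regularized interpolant of `h ∈ H` errs by at most `‖h‖ σ(z)`. -/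
theorem abs_sub_postMean_le {lam : ℝ} (hlam : 0 < lam) (xs : Fin n → X) (z : X) (h : H) :
    |h z - postMean (scalarKernel H) lam xs (fun i => h (xs i)) z| ≤
      ‖h‖ * √(postVar (scalarKernel H) lam xs z) := by
  rw [postMean_eq_dotProduct, ← inner_residual]
  refine (abs_real_inner_le_norm _ _).trans (mul_le_mul_of_nonneg_left ?_ (norm_nonneg _))
  refine Real.le_sqrt_of_sq_le ?_
  rw [← norm_residual_sq_add hlam]
  nlinarith [mul_nonneg hlam.le (dotProduct_self_nonneg (postWeight (scalarKernel H) lam xs z))]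

/-- Sensitivity of the posterior mean to a uniformly bounded perturbation of the observations. -/
theorem abs_postMean_le {lam : ℝ} (hlam : 0 < lam) (xs : Fin n → X) (z : X)
    (hk : scalarKernel H z z ≤ 1) (y : Fin n → ℝ) {c : ℝ} (hc : 0 ≤ c) (hy : ∀ i, |y i| ≤ c) :
    |postMean (scalarKernel H) lam xs y z| ≤ √(n / lam) * c := by
  rw [postMean_eq_dotProduct]
  set w := postWeight (scalarKernel H) lam xs z
  have h1 : w ⬝ᵥ w ≤ 1 / lam := by
    rw [le_div_iff₀ hlam]
    linarith [postWeight_sq_le (H := H) hlam xs z, postVar_le (H := H) hlam xs z]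
  have h2 : y ⬝ᵥ y ≤ n * c ^ 2 := by
    calc y ⬝ᵥ y ≤ ∑ _i : Fin n, c ^ 2 := Finset.sum_le_sum fun i _ => by
          rw [← sq, ← sq_abs]; exact pow_le_pow_left₀ (abs_nonneg _) (hy i) 2
      _ = n * c ^ 2 := by simp
  have h3 : (w ⬝ᵥ y) ^ 2 ≤ (w ⬝ᵥ w) * (y ⬝ᵥ y) := by
    have := Finset.sum_mul_sq_le_sq_mul_sq Finset.univ w y
    simpa [dotProduct, sq] using this
  refine abs_le_of_sq_le_sq (h3.trans ?_) (by positivity)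
  rw [mul_pow, Real.sq_sqrt (by positivity)]
  calc (w ⬝ᵥ w) * (y ⬝ᵥ y) ≤ 1 / lam * (n * c ^ 2) :=
        mul_le_mul h1 h2 (dotProduct_self_nonneg y) (by positivity)
    _ = n / lam * c ^ 2 := by ring

/-- The energy `yᵀ K (K + λ I)⁻¹ y` of a noise vector `y`, written as
`yᵀ y - λ yᵀ (K + λ I)⁻¹ y`. -/
noncomputable def noiseEnergy (k : X → X → ℝ) (lam : ℝ) (xs : Fin n → X) (y : Fin n → ℝ) : ℝ :=
  y ⬝ᵥ y - lam * (y ⬝ᵥ ((regGram k lam xs)⁻¹ *ᵥ y))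

/-- Cauchy–Schwarz in `H × ℝⁿ` for the posterior mean of pure noise. -/
theorem sq_postMean_le {lam : ℝ} (hlam : 0 < lam) (xs : Fin n → X) (z : X) (y : Fin n → ℝ) :
    (postMean (scalarKernel H) lam xs y z) ^ 2 ≤
      postVar (scalarKernel H) lam xs z * (noiseEnergy (scalarKernel H) lam xs y / lam) := by
  rw [postMean_eq_dotProduct, noiseEnergy, ← norm_residual_sq_add hlam]
  set w := postWeight (scalarKernel H) lam xs z
  set u := (regGram (scalarKernel H) lam xs)⁻¹ *ᵥ y with hu
  set v := gram (scalarKernel H) xs *ᵥ u with hv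
  set h : H := ∑ i, u i • RKHS.kerFun H (xs i) (1 : ℝ) with hh
  set r := residual H lam xs z with hr
  have e0 : y = v + lam • u := by
    have := regGram_mulVec_inv (H := H) hlam xs y
    rw [← hu, regGram, Matrix.add_mulVec, Matrix.smul_mulVec, Matrix.one_mulVec] at this
    exact this.symm
  have e1 : ‖h‖ ^ 2 = u ⬝ᵥ v := norm_sum_kerFun_sq xs u
  have hx : (fun i => h (xs i)) = v := by
    funext i
    rw [← inner_kerFun_one, hh, sum_inner]
    simp only [hv, Matrix.mulVec, dotProduct, gram, Matrix.of_apply]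
    refine Finset.sum_congr rfl fun j _ => ?_
    rw [real_inner_smul_left, ← scalarKernel_eq_inner, mul_comm, scalarKernel_comm]
  have hz : h z = w ⬝ᵥ y := by
    rw [← postMean_eq_dotProduct, ← inner_kerFun_one, hh, sum_inner, postMean]
    change _ = kvec (scalarKernel H) xs z ⬝ᵥ u
    refine Finset.sum_congr rfl fun j _ => ?_
    rw [real_inner_smul_left, ← scalarKernel_eq_inner, mul_comm]; rfl
  have e2 : w ⬝ᵥ y = inner ℝ h r + w ⬝ᵥ v := by
    rw [hr, inner_residual, hx, hz]; ring
  have e3 : y ⬝ᵥ y - lam * (y ⬝ᵥ u) = lam * (u ⬝ᵥ v) + v ⬝ᵥ v := by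
    rw [e0]
    simp only [dotProduct_add, add_dotProduct, dotProduct_smul, smul_dotProduct, smul_eq_mul]
    rw [dotProduct_comm v u]; ring
  have c1 : (inner ℝ h r) ^ 2 ≤ ‖r‖ ^ 2 * ‖h‖ ^ 2 := by
    rw [← mul_pow]
    exact sq_le_sq.2 (by rw [abs_mul, abs_norm, abs_norm, mul_comm]
                         exact abs_real_inner_le_norm _ _)
  have c2 : (w ⬝ᵥ v) ^ 2 ≤ (w ⬝ᵥ w) * (v ⬝ᵥ v) := by
    have := Finset.sum_mul_sq_le_sq_mul_sq Finset.univ w v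
    simpa [dotProduct, sq] using this
  have p1 := dotProduct_self_nonneg w
  have p2 := dotProduct_self_nonneg v
  rw [e3, e2, ← e1]
  set a := inner ℝ h r
  set b := w ⬝ᵥ v
  set p := w ⬝ᵥ w
  set q := v ⬝ᵥ v
  have c3 : 2 * (a * b) ≤ ‖r‖ ^ 2 * q / lam + lam * p * ‖h‖ ^ 2 := by
    refine (le_abs_self _).trans (abs_le_of_sq_le_sq ?_ (by positivity))
    have h4 : (a * b) ^ 2 ≤ (‖r‖ ^ 2 * ‖h‖ ^ 2) * (p * q) := by
      rw [mul_pow]; exact mul_le_mul c1 c2 (sq_nonneg _) (by positivity)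
    have h5 : (‖r‖ ^ 2 * q / lam) * (lam * p * ‖h‖ ^ 2) = (‖r‖ ^ 2 * ‖h‖ ^ 2) * (p * q) := by
      field_simp
    nlinarith [sq_nonneg (‖r‖ ^ 2 * q / lam - lam * p * ‖h‖ ^ 2)]
  have h6 : (‖r‖ ^ 2 + lam * p) * ((lam * ‖h‖ ^ 2 + q) / lam) =
      ‖r‖ ^ 2 * ‖h‖ ^ 2 + p * q + (‖r‖ ^ 2 * q / lam + lam * p * ‖h‖ ^ 2) := by
    field_simp; ring
  rw [h6]
  nlinarith

/-! ### Adding one observation -/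

theorem det_succ_eq_mul_schur (M : Matrix (Fin (n + 1)) (Fin (n + 1)) ℝ)
    (A : Matrix (Fin n) (Fin n) ℝ) (v : Fin n → ℝ) (hA : IsUnit A.det)
    (h₁ : ∀ i j, M (Fin.castSucc i) (Fin.castSucc j) = A i j)
    (h₂ : ∀ i, M (Fin.castSucc i) (Fin.last n) = v i)
    (h₃ : ∀ i, M (Fin.last n) (Fin.castSucc i) = v i) :
    M.det = A.det * (M (Fin.last n) (Fin.last n) - v ⬝ᵥ (A⁻¹ *ᵥ v)) := by
  have hM : M.submatrix (finSumFinEquiv (m := n) (n := 1)) (finSumFinEquiv (m := n) (n := 1)) =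
      Matrix.fromBlocks A (Matrix.replicateCol (Fin 1) v) (Matrix.replicateRow (Fin 1) v)
        (Matrix.of fun _ _ => M (Fin.last n) (Fin.last n)) := by
    have e (j : Fin 1) : Fin.natAdd n j = Fin.last n := by
      ext; simp
    ext (i | i) (j | j)
    · exact h₁ i j
    · simp only [Matrix.submatrix_apply, finSumFinEquiv_apply_left, finSumFinEquiv_apply_right, e]
      exact h₂ i
    · simp only [Matrix.submatrix_apply, finSumFinEquiv_apply_left, finSumFinEquiv_apply_right, e]
      exact h₃ j
    · simp [e]
  have : Invertible A := Matrix.invertibleOfIsUnitDet A hA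
  rw [← Matrix.det_submatrix_equiv_self (finSumFinEquiv (m := n) (n := 1)) M, hM,
    Matrix.det_fromBlocks₁₁, Matrix.invOf_eq_nonsing_inv]
  congr 1
  rw [Matrix.det_fin_one, Matrix.sub_apply, Matrix.of_apply, Matrix.mul_assoc]
  congr 1

/-- The quadratic form of the inverse of a bordered matrix, by elimination of the last row. -/
theorem dotProduct_inv_mulVec_succ (M : Matrix (Fin (n + 1)) (Fin (n + 1)) ℝ)
    (A : Matrix (Fin n) (Fin n) ℝ) (v : Fin n → ℝ) (hA : IsUnit A.det) (hM : IsUnit M.det)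
    (hAsymm : (A⁻¹).IsHermitian)
    (h₁ : ∀ i j, M (Fin.castSucc i) (Fin.castSucc j) = A i j)
    (h₂ : ∀ i, M (Fin.castSucc i) (Fin.last n) = v i)
    (h₃ : ∀ i, M (Fin.last n) (Fin.castSucc i) = v i)
    (hs : M (Fin.last n) (Fin.last n) - v ⬝ᵥ (A⁻¹ *ᵥ v) ≠ 0) (y : Fin (n + 1) → ℝ) :
    y ⬝ᵥ (M⁻¹ *ᵥ y) = Fin.init y ⬝ᵥ (A⁻¹ *ᵥ Fin.init y) +
      (y (Fin.last n) - v ⬝ᵥ (A⁻¹ *ᵥ Fin.init y)) ^ 2 /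
        (M (Fin.last n) (Fin.last n) - v ⬝ᵥ (A⁻¹ *ᵥ v)) := by
  set s := M (Fin.last n) (Fin.last n) - v ⬝ᵥ (A⁻¹ *ᵥ v) with hs'
  set y' : Fin n → ℝ := Fin.init y with hy'
  set α := (y (Fin.last n) - v ⬝ᵥ (A⁻¹ *ᵥ y')) / s with hα
  set u : Fin n → ℝ := A⁻¹ *ᵥ y' - α • (A⁻¹ *ᵥ v) with hu
  have hAu : A *ᵥ u = y' - α • v := by
    rw [hu, Matrix.mulVec_sub, Matrix.mulVec_smul, Matrix.mulVec_mulVec, Matrix.mulVec_mulVec,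
      Matrix.mul_nonsing_inv _ hA, Matrix.one_mulVec, Matrix.one_mulVec]
  have hvu : v ⬝ᵥ u = v ⬝ᵥ (A⁻¹ *ᵥ y') - α * (v ⬝ᵥ (A⁻¹ *ᵥ v)) := by
    rw [hu, dotProduct_sub, dotProduct_smul, smul_eq_mul]
  -- the bordered linear system is solved explicitly
  have hsol : M *ᵥ (Fin.snoc u α : Fin (n + 1) → ℝ) = y := by
    funext i
    refine Fin.lastCases ?_ (fun i => ?_) i
    · simp only [Matrix.mulVec, dotProduct, Fin.sum_univ_castSucc, Fin.snoc_castSucc,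
        Fin.snoc_last, h₃]
      change v ⬝ᵥ u + _ = _
      have : α * s = y (Fin.last n) - v ⬝ᵥ (A⁻¹ *ᵥ y') := div_mul_cancel₀ _ hs
      rw [hvu]
      linear_combination this - α * hs'
    · simp only [Matrix.mulVec, dotProduct, Fin.sum_univ_castSucc, Fin.snoc_castSucc,
        Fin.snoc_last, h₁, h₂]
      have := congrFun hAu i
      change (A *ᵥ u) i + _ = _
      rw [this]
      simp [hy', Fin.init]; ring
  have hinv : M⁻¹ *ᵥ y = Fin.snoc u α := by
    rw [← hsol, Matrix.mulVec_mulVec, Matrix.nonsing_inv_mul _ hM, Matrix.one_mulVec]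
  have hsum : y ⬝ᵥ (Fin.snoc u α : Fin (n + 1) → ℝ) = y' ⬝ᵥ u + y (Fin.last n) * α := by
    simp [dotProduct, Fin.sum_univ_castSucc, hy', Fin.init]
  rw [hinv, hsum, hu, dotProduct_sub, dotProduct_smul, smul_eq_mul,
    dotProduct_mulVec_comm hAsymm y' v]
  rw [show (y (Fin.last n) - v ⬝ᵥ (A⁻¹ *ᵥ y')) ^ 2 / s
    = α * (y (Fin.last n) - v ⬝ᵥ (A⁻¹ *ᵥ y')) by rw [hα]; ring]
  ring

/-- The determinant `det (I + λ⁻¹ K)`; half its logarithm is the information gain of `xs`. -/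
noncomputable def infoDet (k : X → X → ℝ) (lam : ℝ) (xs : Fin n → X) : ℝ :=
  ((1 : Matrix (Fin n) (Fin n) ℝ) + lam⁻¹ • gram k xs).det

theorem infoDet_eq (k : X → X → ℝ) {lam : ℝ} (hlam : 0 < lam) (xs : Fin n → X) :
    infoDet k lam xs = (lam⁻¹) ^ n * (regGram k lam xs).det := by
  have : (1 : Matrix (Fin n) (Fin n) ℝ) + lam⁻¹ • gram k xs = lam⁻¹ • regGram k lam xs := by
    rw [regGram, smul_add, smul_smul, inv_mul_cancel₀ hlam.ne', one_smul, add_comm]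
  rw [infoDet, this, Matrix.det_smul, Fintype.card_fin]

theorem regGram_last_sub (k : X → X → ℝ) (lam : ℝ) (xs : Fin (n + 1) → X) :
    regGram k lam xs (Fin.last n) (Fin.last n) - kvec k (Fin.init xs) (xs (Fin.last n)) ⬝ᵥ
      ((regGram k lam (Fin.init xs))⁻¹ *ᵥ kvec k (Fin.init xs) (xs (Fin.last n))) =
      lam + postVar k lam (Fin.init xs) (xs (Fin.last n)) := by
  simp [regGram, gram, postVar]; ring

theorem regGram_castSucc (k : X → X → ℝ) (lam : ℝ) (xs : Fin (n + 1) → X) (i j : Fin n) :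
    regGram k lam xs (Fin.castSucc i) (Fin.castSucc j) = regGram k lam (Fin.init xs) i j := by
  simp [regGram, gram, Fin.init, Matrix.one_apply]

theorem regGram_castSucc_last (k : X → X → ℝ) (lam : ℝ) (xs : Fin (n + 1) → X) (i : Fin n) :
    regGram k lam xs (Fin.castSucc i) (Fin.last n) = kvec k (Fin.init xs) (xs (Fin.last n)) i := by
  simp [regGram, gram, kvec, Fin.init, Fin.ext_iff, i.2.ne]

theorem regGram_last_castSucc (lam : ℝ) (xs : Fin (n + 1) → X) (i : Fin n) :
    regGram (scalarKernel H) lam xs (Fin.last n) (Fin.castSucc i) =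
      kvec (scalarKernel H) (Fin.init xs) (xs (Fin.last n)) i := by
  rw [← regGram_castSucc_last (lam := lam)]
  simp [regGram, gram, Fin.ext_iff, i.2.ne, i.2.ne',
    scalarKernel_comm (H := H) (xs (Fin.last n))]

/-- Chain rule for the information. -/
theorem infoDet_succ {lam : ℝ} (hlam : 0 < lam) (xs : Fin (n + 1) → X) :
    infoDet (scalarKernel H) lam xs = infoDet (scalarKernel H) lam (Fin.init xs) *
      (1 + postVar (scalarKernel H) lam (Fin.init xs) (xs (Fin.last n)) / lam) := by
  rw [infoDet_eq _ hlam, infoDet_eq _ hlam,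
    det_succ_eq_mul_schur _ _ _ (regGram_isUnit_det hlam (Fin.init xs))
      (regGram_castSucc _ lam xs) (regGram_castSucc_last _ lam xs) (regGram_last_castSucc lam xs),
    regGram_last_sub, pow_succ]
  linear_combination (lam⁻¹ ^ n * (regGram (scalarKernel H) lam (Fin.init xs)).det) *
    inv_mul_cancel₀ hlam.ne'

/-- One more noise term changes the energy only through the posterior mean of the earlier noise and
the posterior variance at the new query. -/
theorem noiseEnergy_succ {lam : ℝ} (hlam : 0 < lam) (xs : Fin (n + 1) → X)
    (y : Fin (n + 1) → ℝ) :
    noiseEnergy (scalarKernel H) lam xs y =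
      noiseEnergy (scalarKernel H) lam (Fin.init xs) (Fin.init y) + y (Fin.last n) ^ 2 -
      (y (Fin.last n) -
        postMean (scalarKernel H) lam (Fin.init xs) (Fin.init y) (xs (Fin.last n))) ^ 2 /
        (1 + postVar (scalarKernel H) lam (Fin.init xs) (xs (Fin.last n)) / lam) := by
  have hv := postVar_nonneg (H := H) hlam (Fin.init xs) (xs (Fin.last n))
  rw [noiseEnergy, noiseEnergy,
    dotProduct_inv_mulVec_succ _ _ _ (regGram_isUnit_det hlam (Fin.init xs))
      (regGram_isUnit_det hlam xs) (regGram_inv_isHermitian lam _)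
      (regGram_castSucc _ lam xs) (regGram_castSucc_last _ lam xs) (regGram_last_castSucc lam xs)
      (by rw [regGram_last_sub]; positivity), regGram_last_sub]
  have h1 : y ⬝ᵥ y = Fin.init y ⬝ᵥ Fin.init y + y (Fin.last n) ^ 2 := by
    simp [dotProduct, Fin.sum_univ_castSucc, Fin.init, sq]
  have h2 : kvec (scalarKernel H) (Fin.init xs) (xs (Fin.last n)) ⬝ᵥ
      ((regGram (scalarKernel H) lam (Fin.init xs))⁻¹ *ᵥ Fin.init y) =
      postMean (scalarKernel H) lam (Fin.init xs) (Fin.init y) (xs (Fin.last n)) := rfl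
  rw [h1, h2]
  field_simp
  ring

theorem one_le_infoDet {lam : ℝ} (hlam : 0 < lam) (xs : Fin n → X) :
    1 ≤ infoDet (scalarKernel H) lam xs := by
  induction n with
  | zero => simp [infoDet]
  | succ n ih =>
    rw [infoDet_succ hlam]
    have := postVar_nonneg (H := H) hlam (Fin.init xs) (xs (Fin.last n))
    exact one_le_mul_of_one_le_of_one_le (ih _) (le_add_of_nonneg_right (by positivity))

end Posterior

/-! ### Information gain -/

section InfoGain

variable {X : Type*} {H : Type*} [NormedAddCommGroup H] [InnerProductSpace ℝ H]
  [CompleteSpace H] [RKHS ℝ H X ℝ]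

theorem log_infoDet_nonneg {n : ℕ} {lam : ℝ} (hlam : 0 < lam) (xs : Fin n → X) :
    0 ≤ Real.log (infoDet (scalarKernel H) lam xs) :=
  Real.log_nonneg (one_le_infoDet hlam xs)

theorem log_infoDet_le [Finite X] (k : X → X → ℝ) (lam : ℝ) {n : ℕ} (xs : Fin n → X) :
    Real.log (infoDet k lam xs) ≤ 2 * maxInfoGain k lam n := by
  have h := le_ciSup (f := fun xs : Fin n → X =>
    1 / 2 * Real.log ((1 : Matrix (Fin n) (Fin n) ℝ) + lam⁻¹ • gram k xs).det)
    (Set.finite_range _).bddAbove xs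
  have h' : 1 / 2 * Real.log (infoDet k lam xs) ≤ maxInfoGain k lam n := h
  linarith

theorem maxInfoGain_nonneg {lam : ℝ} (hlam : 0 < lam) (n : ℕ) :
    0 ≤ maxInfoGain (scalarKernel H) lam n :=
  Real.iSup_nonneg fun xs => mul_nonneg (by norm_num) (log_infoDet_nonneg (H := H) hlam xs)

theorem log_infoDet_succ {n : ℕ} {lam : ℝ} (hlam : 0 < lam) (xs : Fin (n + 1) → X) :
    Real.log (infoDet (scalarKernel H) lam xs) =
      Real.log (infoDet (scalarKernel H) lam (Fin.init xs)) +
      Real.log (1 + postVar (scalarKernel H) lam (Fin.init xs) (xs (Fin.last n)) / lam) := by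
  have h1 := one_le_infoDet (H := H) hlam (Fin.init xs)
  have h2 := postVar_nonneg (H := H) hlam (Fin.init xs) (xs (Fin.last n))
  rw [infoDet_succ hlam, Real.log_mul (by positivity) (by positivity)]

theorem maxInfoGain_mono [Finite X] [Nonempty X] {lam : ℝ} (hlam : 0 < lam) :
    Monotone (maxInfoGain (scalarKernel H) lam) := by
  refine monotone_nat_of_le_succ fun n => ?_
  refine Real.iSup_le (fun xs => ?_) (maxInfoGain_nonneg hlam _)
  obtain ⟨z⟩ := ‹Nonempty X›
  have h1 := log_infoDet_le (scalarKernel H) lam (Fin.snoc xs z : Fin (n + 1) → X)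
  rw [log_infoDet_succ hlam, Fin.init_snoc] at h1
  have h2 := postVar_nonneg (H := H) hlam xs z
  have h3 : 0 ≤ Real.log (1 + postVar (scalarKernel H) lam xs
      ((Fin.snoc xs z : Fin (n + 1) → X) (Fin.last n)) / lam) := by
    rw [Fin.snoc_last]
    exact Real.log_nonneg (le_add_of_nonneg_right (by positivity))
  change 1 / 2 * Real.log (infoDet (scalarKernel H) lam xs) ≤ _
  linarith

theorem log_infoDet_le_div {lam : ℝ} (hlam : 0 < lam)
    (hk : ∀ x : X, scalarKernel H x x ≤ 1) {n : ℕ} (xs : Fin n → X) :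
    Real.log (infoDet (scalarKernel H) lam xs) ≤ n / lam := by
  induction n with
  | zero => simp [infoDet]
  | succ n ih =>
    rw [log_infoDet_succ hlam]
    have h0 := postVar_nonneg (H := H) hlam (Fin.init xs) (xs (Fin.last n))
    have h1 := (postVar_le (H := H) hlam (Fin.init xs) (xs (Fin.last n))).trans (hk _)
    have h2 := Real.log_le_sub_one_of_pos
      (show 0 < 1 + postVar (scalarKernel H) lam (Fin.init xs) (xs (Fin.last n)) / lam by
        positivity)
    have h3 := div_le_div_of_nonneg_right h1 hlam.le
    have h4 := ih (Fin.init xs)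
    push_cast
    rw [add_div]
    linarith

theorem maxInfoGain_le {lam : ℝ} (hlam : 0 < lam) (hk : ∀ x : X, scalarKernel H x x ≤ 1) (n : ℕ) :
    maxInfoGain (scalarKernel H) lam n ≤ n / (2 * lam) := by
  refine Real.iSup_le (fun xs => ?_) (by positivity)
  have := log_infoDet_le_div (H := H) hlam hk xs
  change 1 / 2 * Real.log (infoDet (scalarKernel H) lam xs) ≤ _
  rw [show (n : ℝ) / (2 * lam) = 1 / 2 * (n / lam) by ring]
  linarith

theorem infoDet_const (k : X → X → ℝ) (lam : ℝ) (n : ℕ) (x : X) :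
    infoDet k lam (fun _ : Fin n => x) = 1 + n * k x x / lam := by
  have : (1 : Matrix (Fin n) (Fin n) ℝ) + lam⁻¹ • gram k (fun _ : Fin n => x) =
      1 + Matrix.replicateCol Unit (fun _ : Fin n => lam⁻¹ * k x x) *
        Matrix.replicateRow Unit (fun _ : Fin n => (1 : ℝ)) := by
    ext i j
    simp [gram, Matrix.mul_apply]
  rw [infoDet, this, Matrix.det_one_add_replicateCol_mul_replicateRow]
  simp [dotProduct]
  ring

/-- Sampling a single point over and over gains information at a logarithmic rate. -/
theorem log_le_maxInfoGain [Finite X] (k : X → X → ℝ) (lam : ℝ) (n : ℕ) (x : X) :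
    Real.log (1 + n * k x x / lam) ≤ 2 * maxInfoGain k lam n := by
  rw [← infoDet_const]; exact log_infoDet_le _ _ _

theorem window_eq {α : Type*} (W t : ℕ) (u : ℕ → α) :
    window W t u = fun i : Fin (t - blockStart W t) => u (blockStart W t + i) := rfl

theorem blockStart_pos (W t : ℕ) : 1 ≤ blockStart W t := Nat.le_add_left _ _

theorem blockStart_le (W : ℕ) {t : ℕ} (ht : 1 ≤ t) : blockStart W t ≤ t := by
  have := Nat.div_mul_le_self (t - 1) W
  unfold blockStart; omega

theorem lt_blockStart_add {W : ℕ} (hW : 0 < W) (t : ℕ) (ht : 1 ≤ t) : t < blockStart W t + W := by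
  have := Nat.lt_div_mul_add (a := t - 1) hW
  unfold blockStart; omega

/-- The posterior variance at the query of time `t`. -/
noncomputable def queryVar (k : X → X → ℝ) (lam : ℝ) (W : ℕ) (x : ℕ → X) (t : ℕ) : ℝ :=
  postVar k lam (window W t x) (x t)

theorem queryVar_nonneg {lam : ℝ} (hlam : 0 < lam) (W : ℕ) (x : ℕ → X) (t : ℕ) :
    0 ≤ queryVar (scalarKernel H) lam W x t := postVar_nonneg hlam _ _

/-- The chain rule, summed within every block: each completed block contributes at most twice the
maximal information gain, the current one the logarithm of its own determinant. -/
theorem sum_log_queryVar_le [Finite X] [Nonempty X] {lam : ℝ} (hlam : 0 < lam) (W : ℕ)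
    (x : ℕ → X) {T t : ℕ} (ht : 1 ≤ t) (htT : t ≤ T) :
    ∑ s ∈ Finset.Icc 1 t, Real.log (1 + queryVar (scalarKernel H) lam W x s / lam) ≤
      2 * maxInfoGain (scalarKernel H) lam T * ((t - 1) / W : ℕ) +
        Real.log (infoDet (scalarKernel H) lam
          (fun i : Fin (t - blockStart W t + 1) => x (blockStart W t + i))) := by
  have key (t : ℕ) (ht : 1 ≤ t) : Real.log (infoDet (scalarKernel H) lam
          (fun i : Fin (t - blockStart W t + 1) => x (blockStart W t + i))) =
      Real.log (infoDet (scalarKernel H) lam (window W t x)) +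
        Real.log (1 + queryVar (scalarKernel H) lam W x t / lam) := by
    rw [log_infoDet_succ hlam]
    have : blockStart W t + (t - blockStart W t) = t := by
      have := blockStart_le W ht; omega
    simp only [Fin.val_last, this]
    rfl
  induction t, ht using Nat.le_induction with
  | base =>
    rw [key 1 le_rfl]
    have := log_infoDet_nonneg (H := H) hlam (window W 1 x)
    simpa using this
  | succ t ht ih =>
    rw [Finset.sum_Icc_succ_top (by omega), key (t + 1) (by omega)]
    have ih := ih (by omega)
    obtain ⟨m, rfl⟩ : ∃ m, t = m + 1 := ⟨t - 1, by omega⟩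
    by_cases hd : W ∣ m + 1
    · have e : (m + 1 + 1 - 1) / W = (m + 1 - 1) / W + 1 := by
        simp [Nat.succ_div, hd]
      have h1 := log_infoDet_nonneg (H := H) hlam (window W (m + 1 + 1) x)
      have h2 := (log_infoDet_le (scalarKernel H) lam (fun i :
        Fin (m + 1 - blockStart W (m + 1) + 1) => x (blockStart W (m + 1) + i)))
      have h3 := maxInfoGain_mono (H := H) hlam (a := m + 1 - blockStart W (m + 1) + 1) (b := T)
        (by have := blockStart_pos W (m + 1); omega)
      rw [e, Nat.cast_add, Nat.cast_one, mul_add]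
      linarith
    · have e : (m + 1 + 1 - 1) / W = (m + 1 - 1) / W := by
        simp [Nat.succ_div, hd]
      have eb : blockStart W (m + 1 + 1) = blockStart W (m + 1) := by
        simp only [blockStart, e]
      have hb := blockStart_le W ht
      have ew : Real.log (infoDet (scalarKernel H) lam (window W (m + 1 + 1) x)) =
          Real.log (infoDet (scalarKernel H) lam
          (fun i : Fin (m + 1 - blockStart W (m + 1) + 1) => x (blockStart W (m + 1) + i))) := by
        rw [window_eq, eb]
        rw [show m + 1 + 1 - blockStart W (m + 1) = m + 1 - blockStart W (m + 1) + 1 by omega]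
      rw [e, ew]
      linarith

theorem sum_queryVar_le [Finite X] [Nonempty X] {lam : ℝ} (hlam : 0 < lam)
    (hk : ∀ x : X, scalarKernel H x x ≤ 1) (W : ℕ) (x : ℕ → X) {T : ℕ} (hT : 1 ≤ T) :
    ∑ t ∈ Finset.Icc 1 T, queryVar (scalarKernel H) lam W x t ≤
      (lam + 1) * (2 * maxInfoGain (scalarKernel H) lam T * (T / W + 1)) := by
  have h1 := sum_log_queryVar_le (H := H) hlam W x hT le_rfl
  have h2 := log_infoDet_le (scalarKernel H) lam
    (fun i : Fin (T - blockStart W T + 1) => x (blockStart W T + i))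
  have h3 := maxInfoGain_mono (H := H) hlam (a := T - blockStart W T + 1) (b := T)
    (by have := blockStart_pos W T; omega)
  have h0 := maxInfoGain_nonneg (H := H) hlam T
  have h4 : (((T - 1) / W : ℕ) : ℝ) ≤ T / W :=
    (Nat.cast_div_le).trans (div_le_div_of_nonneg_right (by exact_mod_cast Nat.sub_le T 1)
      (by positivity))
  have h5 : ∑ t ∈ Finset.Icc 1 T, queryVar (scalarKernel H) lam W x t ≤
      (lam + 1) *
        ∑ t ∈ Finset.Icc 1 T, Real.log (1 + queryVar (scalarKernel H) lam W x t / lam) := by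
    rw [Finset.mul_sum]
    refine Finset.sum_le_sum fun t _ => ?_
    have p0 := queryVar_nonneg (H := H) hlam W x t
    have p1 : queryVar (scalarKernel H) lam W x t ≤ 1 := (postVar_le hlam _ _).trans (hk _)
    set v := queryVar (scalarKernel H) lam W x t
    -- `log (1 + u) ≥ u / (1 + u)` with `u = v / λ ≤ 1 / λ`
    have p2 := Real.one_sub_inv_le_log_of_pos (show 0 < 1 + v / lam by positivity)
    have p3 : 1 - (1 + v / lam)⁻¹ = v / (lam + v) := by field_simp; ring
    rw [p3] at p2
    have p4 : v / (lam + 1) ≤ v / (lam + v) :=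
      div_le_div_of_nonneg_left p0 (by positivity) (by linarith)
    have p5 := p4.trans p2
    rw [div_le_iff₀ (by positivity)] at p5
    linarith
  refine h5.trans (mul_le_mul_of_nonneg_left ?_ (by positivity))
  have := mul_le_mul_of_nonneg_left h4 h0
  linarith

/-- The posterior standard deviations at the queries have a sum of order `√(T · (T / W) · γ_T)`. -/
theorem sum_sqrt_queryVar_le [Finite X] [Nonempty X] {lam : ℝ} (hlam : 0 < lam)
    (hk : ∀ x : X, scalarKernel H x x ≤ 1) (W : ℕ) (x : ℕ → X) {T : ℕ} (hT : 1 ≤ T) :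
    ∑ t ∈ Finset.Icc 1 T, √(queryVar (scalarKernel H) lam W x t) ≤
      √(T * ((lam + 1) * (2 * maxInfoGain (scalarKernel H) lam T * (T / W + 1)))) := by
  refine Real.le_sqrt_of_sq_le ((sq_sum_le_card_mul_sum_sq).trans ?_)
  rw [Nat.card_Icc, Nat.add_sub_cancel]
  refine mul_le_mul_of_nonneg_left ?_ (by positivity)
  rw [Finset.sum_congr rfl fun t _ => Real.sq_sqrt (queryVar_nonneg (H := H) hlam W x t)]
  exact sum_queryVar_le hlam hk W x hT

/-- The variation accumulated since the last restart. -/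
def blockDrift (W : ℕ) (v : ℕ → ℝ) (t : ℕ) : ℝ := ∑ s ∈ Finset.Ico (blockStart W t) t, v s

theorem blockDrift_nonneg (W : ℕ) {v : ℕ → ℝ} (hv : ∀ s, 0 ≤ v s) (t : ℕ) :
    0 ≤ blockDrift W v t := Finset.sum_nonneg fun s _ => hv s

/-- Every variation term is felt at fewer than `W` later times. -/
theorem sum_blockDrift_le {W : ℕ} (hW : 0 < W) {v : ℕ → ℝ} (hv : ∀ s, 0 ≤ v s) (T : ℕ) :
    ∑ t ∈ Finset.Icc 1 T, blockDrift W v t ≤ W * ∑ s ∈ Finset.Ico 1 T, v s := by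
  have h1 : ∑ t ∈ Finset.Icc 1 T, blockDrift W v t =
      ∑ s ∈ Finset.Ico 1 T, ∑ t ∈ Finset.Icc 1 T with blockStart W t ≤ s ∧ s < t, v s := by
    refine Finset.sum_comm' fun t s => ?_
    have := blockStart_pos W t
    simp only [Finset.mem_Icc, Finset.mem_Ico, Finset.mem_filter]
    omega
  rw [h1, Finset.mul_sum]
  refine Finset.sum_le_sum fun s _ => ?_
  rw [Finset.sum_const, nsmul_eq_mul]
  refine mul_le_mul_of_nonneg_right ?_ (hv s)
  have h2 : (Finset.Icc 1 T).filter (fun t => blockStart W t ≤ s ∧ s < t) ⊆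
      Finset.Ico (s + 1) (s + 1 + W) := by
    intro t ht
    simp only [Finset.mem_filter, Finset.mem_Icc, Finset.mem_Ico] at ht ⊢
    have := lt_blockStart_add hW t ht.1.1
    omega
  have h3 := Finset.card_le_card h2
  rw [Nat.card_Ico, Nat.add_sub_cancel_left] at h3
  exact_mod_cast h3

/-! ### Confidence bounds -/

/-- The noise of the current block has the energy that the self-normalized bound allows. -/
def NoiseControlled (k : X → X → ℝ) (p : Params) (x : ℕ → X) (ξ : ℕ → ℝ) (t : ℕ) : Prop :=
  noiseEnergy k p.lam (window p.W t x) (window p.W t ξ) ≤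
    p.R ^ 2 * (2 * Real.log (1 / p.delta) + Real.log (infoDet k p.lam (window p.W t x)))

/-- The confidence bound of a time-varying unknown function at the times of controlled noise. -/
theorem abs_sub_postMean_window_le [Finite X] {p : Params} (hlam : 0 < p.lam) (hR : 0 ≤ p.R)
    (hW : 0 < p.W) (hk : ∀ x : X, scalarKernel H x x ≤ 1) {b : ℝ} (h : ℕ → H) (x : ℕ → X)
    (ξ : ℕ → ℝ) {t : ℕ} (ht : 1 ≤ t) (hb : ‖h t‖ ≤ b)
    (hξ : NoiseControlled (scalarKernel H) p x ξ t) (z : X) :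
    |h t z - postMean (scalarKernel H) p.lam (window p.W t x)
        (window p.W t fun s => h s (x s) + ξ s) z| ≤
      confWidth (scalarKernel H) p b (t - blockStart p.W t) *
        √(postVar (scalarKernel H) p.lam (window p.W t x) z) +
      √(p.W / p.lam) * blockDrift p.W (fun s => ‖h (s + 1) - h s‖) t := by
  set xs := window p.W t x with hxs
  set σ := √(postVar (scalarKernel H) p.lam xs z) with hσ
  set d := blockDrift p.W (fun s => ‖h (s + 1) - h s‖) t with hd
  have hd0 : 0 ≤ d := blockDrift_nonneg _ (fun s => norm_nonneg _) _
  have hσ0 : 0 ≤ σ := Real.sqrt_nonneg _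
  have hbt := blockStart_le p.W ht
  -- the observations are those of `h t`, plus the drift of `h`, plus the noise
  have e : (window p.W t fun s => h s (x s) + ξ s) =
      (fun i => h t (xs i)) + (window p.W t fun s => (h s - h t) (x s)) + window p.W t ξ := by
    funext i
    simp [hxs, window]
  rw [e, postMean_add, postMean_add]
  have h1 := abs_sub_postMean_le (H := H) hlam xs z (h t)
  have h2 : |postMean (scalarKernel H) p.lam xs (window p.W t fun s => (h s - h t) (x s)) z| ≤
      √(p.W / p.lam) * d := by
    refine (abs_postMean_le hlam xs z (hk z) _ hd0 fun i => ?_).trans ?_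
    · refine (abs_apply_le _ _ (hk _)).trans ?_
      rw [← dist_eq_norm]
      refine (dist_le_Ico_sum_dist h (m := blockStart p.W t + i) (n := t) (by omega)).trans ?_
      rw [hd, blockDrift]
      rw [Finset.sum_congr rfl fun s _ => by rw [dist_comm, dist_eq_norm]]
      exact Finset.sum_le_sum_of_subset_of_nonneg (Finset.Ico_subset_Ico_left (by omega))
        fun _ _ _ => norm_nonneg _
    · refine mul_le_mul_of_nonneg_right (Real.sqrt_le_sqrt ?_) hd0
      refine div_le_div_of_nonneg_right ?_ hlam.le
      have := lt_blockStart_add hW t ht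
      exact_mod_cast (by omega : t - blockStart p.W t ≤ p.W)
  have h3 : |postMean (scalarKernel H) p.lam xs (window p.W t ξ) z| ≤
      1 / √p.lam * p.R * √(2 * Real.log (1 / p.delta) +
        2 * maxInfoGain (scalarKernel H) p.lam (t - blockStart p.W t)) * σ := by
    set L := 2 * Real.log (1 / p.delta) +
        2 * maxInfoGain (scalarKernel H) p.lam (t - blockStart p.W t) with hL
    have q1 : noiseEnergy (scalarKernel H) p.lam xs (window p.W t ξ) ≤ p.R ^ 2 * L := by
      refine hξ.trans (mul_le_mul_of_nonneg_left ?_ (sq_nonneg _))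
      have := log_infoDet_le (scalarKernel H) p.lam xs
      linarith
    have q2 := sq_postMean_le (H := H) hlam xs z (window p.W t ξ)
    have q3 := postVar_nonneg (H := H) hlam xs z
    have q4 : (postMean (scalarKernel H) p.lam xs (window p.W t ξ) z) ^ 2 ≤
        (p.R ^ 2 * L / p.lam) * postVar (scalarKernel H) p.lam xs z := by
      refine q2.trans ?_
      rw [mul_comm]
      exact mul_le_mul_of_nonneg_right (div_le_div_of_nonneg_right q1 hlam.le) q3
    calc |postMean (scalarKernel H) p.lam xs (window p.W t ξ) z|
        ≤ √((p.R ^ 2 * L / p.lam) * postVar (scalarKernel H) p.lam xs z) :=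
          Real.abs_le_sqrt q4
      _ = 1 / √p.lam * p.R * √L * σ := by
          rw [Real.sqrt_mul' _ q3, Real.sqrt_div' _ hlam.le, Real.sqrt_mul (sq_nonneg _),
            Real.sqrt_sq hR]
          ring
  have h4 : ‖h t‖ * σ ≤ b * σ := mul_le_mul_of_nonneg_right hb hσ0
  rw [confWidth, add_mul]
  rw [abs_le] at *
  constructor <;> linarith [h1.1, h1.2, h2.1, h2.2, h3.1, h3.2]

theorem le_clamp {lo hi v a d : ℝ} (hd : 0 ≤ d) (ha : a ≤ hi) (hv : a ≤ v + d) :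
    a ≤ clamp lo hi v + d := by
  unfold clamp
  have := le_max_right lo (min hi v)
  have : a - d ≤ min hi v := le_min (by linarith) (by linarith)
  linarith

theorem clamp_le {lo hi v a : ℝ} (ha : lo ≤ a) (hv : v ≤ a) : clamp lo hi v ≤ a :=
  max_le ha ((min_le_right _ _).trans hv)

theorem abs_clamp_le {b v : ℝ} (hb : 0 ≤ b) : |clamp (-b) b v| ≤ b :=
  abs_le.2 ⟨le_max_left _ _, max_le (by linarith) (min_le_left _ _)⟩

theorem clamp_mem {b v : ℝ} (hb : 0 ≤ b) : 0 ≤ clamp 0 b v ∧ clamp 0 b v ≤ b :=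
  ⟨le_max_left _ _, max_le hb (min_le_left _ _)⟩

end InfoGain

/-! ### Primal-dual analysis with optimistic estimates -/

section PrimalDual

variable {X : Type*}

theorem policyMean_mono [Fintype X] {π : X → ℝ} (hπ : π ∈ stdSimplex ℝ X) {h h' : X → ℝ}
    (hh : ∀ z, h z ≤ h' z) :
    policyMean π h ≤ policyMean π h' :=
  Finset.sum_le_sum fun z _ => mul_le_mul_of_nonneg_left (hh z) (hπ.1 z)

theorem policyMean_const [Fintype X] {π : X → ℝ} (hπ : π ∈ stdSimplex ℝ X) (c : ℝ) :
    policyMean π (fun _ => c) = c := by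
  rw [policyMean, ← Finset.sum_mul, hπ.2, one_mul]

theorem policyMean_add [Fintype X] (π h h' : X → ℝ) :
    policyMean π (fun z => h z + h' z) = policyMean π h + policyMean π h' := by
  simp [policyMean, mul_add, Finset.sum_add_distrib]

theorem policyMean_sub_mul [Fintype X] (π h h' : X → ℝ) (c : ℝ) :
    policyMean π (fun z => h z - c * h' z) = policyMean π h - c * policyMean π h' := by
  simp only [policyMean, mul_sub, Finset.sum_sub_distrib, Finset.mul_sum]
  congr 1
  exact Finset.sum_congr rfl fun z _ => by ring

theorem policyMean_le_add [Fintype X] {π : X → ℝ} (hπ : π ∈ stdSimplex ℝ X) {h h' : X → ℝ} {c : ℝ}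
    (hh : ∀ z, h z ≤ h' z + c) : policyMean π h ≤ policyMean π h' + c := by
  refine (policyMean_mono hπ hh).trans ?_
  rw [policyMean_add π h' (fun _ => c), policyMean_const hπ]

/-- A primal-dual run on optimistic estimates: the queries `x t` maximize `F t - φ t · Q t`, the
dual variable follows projected steps along `Q t (x t)`, and `F`, `Q` estimate the rewards `f` and
the constraints `g` up to drifts `D`, `D'` and, at the queries, up to widths `e`, `e'`. -/
structure OptimisticRun (f g F Q : ℕ → X → ℝ) (x : ℕ → X) (φ D D' e e' : ℕ → ℝ)
    (B G ρ : ℝ) (T : ℕ) : Prop where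
  B_pos : 0 < B
  G_pos : 0 < G
  rho_pos : 0 < ρ
  T_pos : 1 ≤ T
  dual_init : φ 1 = 0
  select : ∀ t ∈ Finset.Icc 1 T, ∀ z, F t z - φ t * Q t z ≤ F t (x t) - φ t * Q t (x t)
  dual_step : ∀ t ∈ Finset.Icc 1 T, φ (t + 1) = clamp 0 ρ (φ t + ρ / (G * √T) * Q t (x t))
  reward_bound : ∀ t ∈ Finset.Icc 1 T, ∀ z, |F t z| ≤ B
  constraint_bound : ∀ t ∈ Finset.Icc 1 T, ∀ z, |Q t z| ≤ G
  drift_nonneg : ∀ t ∈ Finset.Icc 1 T, 0 ≤ D' t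
  reward_le : ∀ t ∈ Finset.Icc 1 T, ∀ z, f t z ≤ F t z + D t
  le_reward : ∀ t ∈ Finset.Icc 1 T, F t (x t) ≤ f t (x t) + e t + D t
  le_constraint : ∀ t ∈ Finset.Icc 1 T, ∀ z, Q t z ≤ g t z + D' t
  constraint_le : ∀ t ∈ Finset.Icc 1 T, g t (x t) ≤ Q t (x t) + e' t + D' t

namespace OptimisticRun

variable {f g F Q : ℕ → X → ℝ} {x : ℕ → X} {φ D D' e e' : ℕ → ℝ} {B G ρ : ℝ} {T : ℕ}

theorem eta_pos (h : OptimisticRun f g F Q x φ D D' e e' B G ρ T) :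
    0 < ρ / (G * √T) := by
  have := h.G_pos
  have := h.rho_pos
  have : (0 : ℝ) < T := by exact_mod_cast h.T_pos
  positivity

theorem dual_mem (h : OptimisticRun f g F Q x φ D D' e e' B G ρ T)
    {t : ℕ} (ht : t ∈ Finset.Icc 1 T) : 0 ≤ φ t ∧ φ t ≤ ρ := by
  rw [Finset.mem_Icc] at ht
  obtain ⟨m, rfl⟩ : ∃ m, t = m + 1 := ⟨t - 1, by omega⟩
  rcases Nat.eq_zero_or_pos m with rfl | hm
  · rw [zero_add, h.dual_init]; exact ⟨le_rfl, h.rho_pos.le⟩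
  · rw [h.dual_step m (Finset.mem_Icc.2 ⟨hm, by omega⟩)]; exact clamp_mem h.rho_pos.le

theorem policyMean_lagrangian_le [Fintype X] (h : OptimisticRun f g F Q x φ D D' e e' B G ρ T)
    {t : ℕ} (ht : t ∈ Finset.Icc 1 T) {π : X → ℝ} (hπ : π ∈ stdSimplex ℝ X) :
    policyMean π (F t) - φ t * policyMean π (Q t) ≤ F t (x t) - φ t * Q t (x t) := by
  rw [← policyMean_sub_mul, ← policyMean_const hπ (F t (x t) - φ t * Q t (x t))]
  exact policyMean_mono hπ (h.select t ht)

theorem neg_dual_mul_le (h : OptimisticRun f g F Q x φ D D' e e' B G ρ T)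
    {t : ℕ} (ht : t ∈ Finset.Icc 1 T) :
    -(φ t * Q t (x t)) ≤
      (φ t ^ 2 - φ (t + 1) ^ 2) / (2 * (ρ / (G * √T))) + ρ / (G * √T) * G ^ 2 / 2 := by
  have hη := h.eta_pos
  set η := ρ / (G * √T)
  have hq : Q t (x t) ^ 2 ≤ G ^ 2 := by
    rw [← sq_abs]
    exact pow_le_pow_left₀ (abs_nonneg _) (h.constraint_bound t ht _) 2
  have hstep : φ (t + 1) ^ 2 ≤ (φ t + η * Q t (x t)) ^ 2 := by
    rw [h.dual_step t ht]
    refine sq_le_sq.2 ?_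
    rw [abs_of_nonneg (clamp_mem h.rho_pos.le).1]
    exact max_le (abs_nonneg _) ((min_le_right _ _).trans (le_abs_self _))
  have h1 : η * Q t (x t) ^ 2 ≤ η * G ^ 2 := mul_le_mul_of_nonneg_left hq hη.le
  rw [← sub_le_iff_le_add, le_div_iff₀ (by positivity)]
  nlinarith

/-- The dual variable makes the Lagrangian term of the regret telescope. -/
theorem regret_le [Fintype X] (h : OptimisticRun f g F Q x φ D D' e e' B G ρ T)
    {πs : ℕ → X → ℝ} (hπ : ∀ t ∈ Finset.Icc 1 T, πs t ∈ stdSimplex ℝ X)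
    (hg : ∀ t ∈ Finset.Icc 1 T, policyMean (πs t) (g t) ≤ 0) :
    regret f πs x T ≤ ρ * G * √T / 2 +
      ∑ t ∈ Finset.Icc 1 T, (2 * D t + ρ * D' t + e t) := by
  have hη := h.eta_pos
  have hT : (0 : ℝ) < T := by exact_mod_cast h.T_pos
  have hstep : ∀ t ∈ Finset.Icc 1 T, policyMean (πs t) (f t) - f t (x t) ≤
      ((φ t ^ 2 - φ (t + 1) ^ 2) / (2 * (ρ / (G * √T))) + ρ / (G * √T) * G ^ 2 / 2) +
        (2 * D t + ρ * D' t + e t) := by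
    intro t ht
    have h1 := policyMean_le_add (hπ t ht) (h.reward_le t ht)
    have h2 := policyMean_le_add (hπ t ht) (h.le_constraint t ht)
    have h3 := h.policyMean_lagrangian_le ht (hπ t ht)
    have h4 := h.le_reward t ht
    have h5 := h.neg_dual_mul_le ht
    have h6 := h.dual_mem ht
    have h7 : φ t * policyMean (πs t) (Q t) ≤ ρ * D' t := by
      calc φ t * policyMean (πs t) (Q t) ≤ φ t * D' t :=
            mul_le_mul_of_nonneg_left (by linarith [hg t ht]) h6.1
        _ ≤ ρ * D' t := mul_le_mul_of_nonneg_right h6.2 (h.drift_nonneg t ht)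
    linarith
  have htel : ∑ t ∈ Finset.Icc 1 T, (φ t ^ 2 - φ (t + 1) ^ 2) = φ 1 ^ 2 - φ (T + 1) ^ 2 := by
    have := Finset.sum_Ico_sub (fun t => φ t ^ 2) (show 1 ≤ T + 1 by omega)
    rw [← Finset.Ico_add_one_right_eq_Icc, ← neg_inj, ← Finset.sum_neg_distrib]
    simpa using this
  rw [regret, ← Finset.sum_sub_distrib]
  refine (Finset.sum_le_sum hstep).trans ?_
  rw [Finset.sum_add_distrib, Finset.sum_add_distrib, ← Finset.sum_div, htel, Finset.sum_const,
    Nat.card_Icc, Nat.add_sub_cancel, nsmul_eq_mul, h.dual_init]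
  have h8 : (0 ^ 2 - φ (T + 1) ^ 2) / (2 * (ρ / (G * √T))) ≤ 0 :=
    div_nonpos_of_nonpos_of_nonneg (by nlinarith [sq_nonneg (φ (T + 1))]) (by positivity)
  have h9 : (T : ℝ) * (ρ / (G * √T) * G ^ 2 / 2) = ρ * G * √T / 2 := by
    have h10 : (T : ℝ) = √T * √T := (Real.mul_self_sqrt hT.le).symm
    have := h.G_pos
    have : 0 < √(T : ℝ) := Real.sqrt_pos.2 hT
    nth_rewrite 1 [h10]
    field_simp
  rw [h9]
  linarith

/-- Under the Slater condition the cap `ρ` of the dual variable truncates a step by at most `η D'`: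
near the cap the maximized Lagrangian forces the estimated constraint value below `D'`. -/
theorem dual_add_le [Fintype X] (h : OptimisticRun f g F Q x φ D D' e e' B G ρ T)
    {τ : ℝ} (hτ : 0 < τ) (hρ : 4 * B / τ ≤ ρ) (hT : 4 ≤ T)
    (hS : ∀ t ∈ Finset.Icc 1 T, ∃ π ∈ stdSimplex ℝ X, policyMean π (g t) ≤ -τ)
    {t : ℕ} (ht : t ∈ Finset.Icc 1 T) :
    φ t + ρ / (G * √T) * Q t (x t) ≤ φ (t + 1) + ρ / (G * √T) * D' t := by
  have hη := h.eta_pos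
  have hD := h.drift_nonneg t ht
  have hφ := h.dual_mem ht
  have hB := h.B_pos
  rw [h.dual_step t ht]
  have hG := h.G_pos
  have hρ0 := h.rho_pos
  have hηG : ρ / (G * √T) * G ≤ ρ / 2 := by
    have h2 : (2 : ℝ) ≤ √T := Real.le_sqrt_of_sq_le (by norm_num; exact_mod_cast hT)
    have e1 : ρ / (G * √T) * G = ρ / √T := by field_simp
    rw [e1]
    exact div_le_div_of_nonneg_left hρ0.le (by norm_num) h2
  set η := ρ / (G * √T)
  by_cases hc : φ t + η * Q t (x t) ≤ ρ
  · rw [clamp, min_eq_right hc]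
    have := le_max_right 0 (φ t + η * Q t (x t))
    nlinarith
  · push Not at hc
    rw [clamp, min_eq_left hc.le, max_eq_right hρ0.le]
    have hQ : Q t (x t) ≤ G := (abs_le.1 (h.constraint_bound t ht _)).2
    -- a truncated step starts above `ρ - η G ≥ ρ / 2 ≥ 2 B / τ`
    have h1 : 2 * B ≤ φ t * τ := by
      have h2 : η * Q t (x t) ≤ η * G := mul_le_mul_of_nonneg_left hQ hη.le
      have h3 : ρ / 2 ≤ φ t := by linarith
      rw [div_le_iff₀ hτ] at hρ
      nlinarith
    have hφ0 : 0 < φ t := by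
      by_contra hn
      have : φ t * τ ≤ 0 := mul_nonpos_of_nonpos_of_nonneg (not_lt.1 hn) hτ.le
      linarith
    obtain ⟨π, hπ, hπg⟩ := hS t ht
    have h4 := h.policyMean_lagrangian_le ht hπ
    have h5 : -B ≤ policyMean π (F t) := by
      rw [← policyMean_const hπ (-B)]
      exact policyMean_mono hπ fun z => (abs_le.1 (h.reward_bound t ht z)).1
    have h6 : F t (x t) ≤ B := (abs_le.1 (h.reward_bound t ht _)).2
    have h7 := policyMean_le_add hπ (h.le_constraint t ht)
    have h8 : φ t * policyMean π (Q t) ≤ φ t * (-τ + D' t) :=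
      mul_le_mul_of_nonneg_left (by linarith) hφ0.le
    have h9 : φ t * Q t (x t) ≤ φ t * D' t := by nlinarith
    have h10 : Q t (x t) ≤ D' t := le_of_mul_le_mul_left h9 hφ0
    have h11 := mul_le_mul_of_nonneg_left h10 hη.le
    linarith

theorem sum_constraint_le [Fintype X] (h : OptimisticRun f g F Q x φ D D' e e' B G ρ T)
    {τ : ℝ} (hτ : 0 < τ) (hρ : 4 * B / τ ≤ ρ) (hT : 4 ≤ T)
    (hS : ∀ t ∈ Finset.Icc 1 T, ∃ π ∈ stdSimplex ℝ X, policyMean π (g t) ≤ -τ) :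
    ∑ t ∈ Finset.Icc 1 T, g t (x t) ≤ G * √T + ∑ t ∈ Finset.Icc 1 T, (2 * D' t + e' t) := by
  have hη := h.eta_pos
  have hG := h.G_pos
  have hρ0 := h.rho_pos
  have hT0 : (0 : ℝ) < T := by exact_mod_cast h.T_pos
  have htel : ∑ t ∈ Finset.Icc 1 T, (φ (t + 1) - φ t) = φ (T + 1) - φ 1 := by
    rw [← Finset.Ico_add_one_right_eq_Icc]
    exact Finset.sum_Ico_sub φ (by omega)
  have hlast : φ (T + 1) ≤ ρ := by
    rw [h.dual_step T (Finset.mem_Icc.2 ⟨h.T_pos, le_rfl⟩)]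
    exact (clamp_mem hρ0.le).2
  have h1 : ∑ t ∈ Finset.Icc 1 T, ρ / (G * √T) * (Q t (x t) - D' t) ≤
      ∑ t ∈ Finset.Icc 1 T, (φ (t + 1) - φ t) := by
    refine Finset.sum_le_sum fun t ht => ?_
    have := h.dual_add_le hτ hρ hT hS ht
    linarith
  rw [htel, h.dual_init, ← Finset.mul_sum] at h1
  have h2 : ∑ t ∈ Finset.Icc 1 T, (Q t (x t) - D' t) ≤ G * √T := by
    refine le_of_mul_le_mul_left (h1.trans ?_) hη
    have : ρ / (G * √T) * (G * √T) = ρ := div_mul_cancel₀ _ (by positivity)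
    linarith
  have h3 : ∑ t ∈ Finset.Icc 1 T, g t (x t) ≤
      ∑ t ∈ Finset.Icc 1 T, ((Q t (x t) - D' t) + (2 * D' t + e' t)) :=
    Finset.sum_le_sum fun t ht => by linarith [h.constraint_le t ht]
  rw [Finset.sum_add_distrib] at h3
  linarith

theorem violation_le [Fintype X] (h : OptimisticRun f g F Q x φ D D' e e' B G ρ T)
    {τ : ℝ} (hτ : 0 < τ) (hρ : 4 * B / τ ≤ ρ)
    (hS : ∀ t ∈ Finset.Icc 1 T, ∃ π ∈ stdSimplex ℝ X, policyMean π (g t) ≤ -τ)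
    (hgG : ∀ t ∈ Finset.Icc 1 T, ∀ z, g t z ≤ G) (he : ∀ t ∈ Finset.Icc 1 T, 0 ≤ e' t) :
    violation g x T ≤ 2 * (G * √T) + ∑ t ∈ Finset.Icc 1 T, (2 * D' t + e' t) := by
  have hG := h.G_pos
  have hpos : 0 ≤ ∑ t ∈ Finset.Icc 1 T, (2 * D' t + e' t) :=
    Finset.sum_nonneg fun t ht => by linarith [h.drift_nonneg t ht, he t ht]
  have hGT : 0 ≤ G * √T := by positivity
  refine max_le ?_ (by linarith)
  rcases le_or_gt 4 T with hT4 | hT4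
  · linarith [h.sum_constraint_le hτ hρ hT4 hS]
  · -- for `T < 4` the trivial bound `G T ≤ 2 G √T` suffices
    have h1 : ∑ t ∈ Finset.Icc 1 T, g t (x t) ≤ T * G :=
      (Finset.sum_le_sum fun t ht => hgG t ht (x t)).trans_eq (by simp)
    have h2 : √(T : ℝ) ≤ 2 := Real.sqrt_le_iff.2 ⟨by norm_num, by norm_num; exact_mod_cast hT4.le⟩
    have h3 : (T : ℝ) ≤ 2 * √T := by
      nlinarith [Real.mul_self_sqrt (Nat.cast_nonneg (α := ℝ) T), Real.sqrt_nonneg (T : ℝ)]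
    have h4 := mul_le_mul_of_nonneg_right h3 hG.le
    linarith

end OptimisticRun

end PrimalDual

/-! ### Sub-Gaussian noise and the method of mixtures -/

section Noise

open scoped ENNReal

variable {Ω : Type*} {m mΩ : MeasurableSpace Ω} {μ : Measure Ω}
  {R : ℝ} {ξ : Ω → ℝ}

theorem setLIntegral_exp_le [IsProbabilityMeasure μ] (hm : m ≤ mΩ)
    (hξ : CondSubGaussian μ m R ξ) (s : ℝ) {A : Set Ω}
    (hA : MeasurableSet[m] A) :
    ∫⁻ ω in A, ENNReal.ofReal (Real.exp (s * ξ ω)) ∂μ ≤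
      ENNReal.ofReal (Real.exp (s ^ 2 * R ^ 2 / 2)) * μ A := by
  obtain ⟨hi, hc⟩ := hξ s
  rw [← ofReal_integral_eq_lintegral_ofReal hi.integrableOn
    (Filter.Eventually.of_forall fun _ => (Real.exp_pos _).le), ← setIntegral_condExp hm hi hA]
  have h1 : ∫ ω in A, (μ[fun ω => Real.exp (s * ξ ω) | m]) ω ∂μ ≤
      ∫ _ω in A, Real.exp (s ^ 2 * R ^ 2 / 2) ∂μ :=
    setIntegral_mono_ae integrable_condExp.integrableOn (integrable_const _).integrableOn hc
  refine (ENNReal.ofReal_le_ofReal h1).trans_eq ?_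
  rw [setIntegral_const, smul_eq_mul, mul_comm, ENNReal.ofReal_mul (Real.exp_pos _).le,
    ofReal_measureReal]

theorem lintegral_mul_exp_const_le [IsProbabilityMeasure μ] (hm : m ≤ mΩ)
    (hξ : CondSubGaussian μ m R ξ) (s : ℝ)
    {Z : Ω → ℝ≥0∞} (hZ : Measurable[m] Z) :
    ∫⁻ ω, Z ω * ENNReal.ofReal (Real.exp (s * ξ ω)) ∂μ ≤
      ENNReal.ofReal (Real.exp (s ^ 2 * R ^ 2 / 2)) * ∫⁻ ω, Z ω ∂μ := by
  set e : Ω → ℝ≥0∞ := fun ω => ENNReal.ofReal (Real.exp (s * ξ ω))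
  have he : AEMeasurable e μ := (hξ s).1.aemeasurable.ennreal_ofReal
  have h1 : (μ.withDensity e).trim hm ≤
      ENNReal.ofReal (Real.exp (s ^ 2 * R ^ 2 / 2)) • μ.trim hm := by
    refine Measure.le_iff.2 fun A hA => ?_
    rw [trim_measurableSet_eq hm hA, Measure.smul_apply, smul_eq_mul, trim_measurableSet_eq hm hA,
      withDensity_apply _ (hm A hA)]
    exact setLIntegral_exp_le hm hξ s hA
  calc ∫⁻ ω, Z ω * e ω ∂μ = ∫⁻ ω, Z ω ∂(μ.withDensity e) := by
        rw [lintegral_withDensity_eq_lintegral_mul₀ he (hZ.mono hm le_rfl).aemeasurable]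
        exact lintegral_congr fun ω => mul_comm _ _
    _ = ∫⁻ ω, Z ω ∂((μ.withDensity e).trim hm) := (lintegral_trim hm hZ).symm
    _ ≤ ∫⁻ ω, Z ω ∂(ENNReal.ofReal (Real.exp (s ^ 2 * R ^ 2 / 2)) • μ.trim hm) :=
        lintegral_mono' h1 le_rfl
    _ = _ := by rw [lintegral_smul_measure, lintegral_trim hm hZ, smul_eq_mul]

/-- Rounding of `s · (n + 1)` to an integer, towards zero, so that `roundToZero n s / (n + 1)`
approximates `s` without exceeding it in absolute value. -/
noncomputable def roundToZero (n : ℕ) (s : ℝ) : ℤ :=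
  if 0 ≤ s then ⌊s * (n + 1)⌋ else ⌈s * (n + 1)⌉

theorem measurable_roundToZero (n : ℕ) : Measurable (roundToZero n) := by
  refine Measurable.ite measurableSet_Ici ?_ ?_
  · exact Int.measurable_floor.comp (measurable_id.mul_const _)
  · exact Int.measurable_ceil.comp (measurable_id.mul_const _)

theorem roundToZero_div_sq_le (n : ℕ) (s : ℝ) : ((roundToZero n s : ℝ) / (n + 1)) ^ 2 ≤ s ^ 2 := by
  have hn : (0 : ℝ) < n + 1 := by positivity
  rw [div_pow, div_le_iff₀ (by positivity), ← mul_pow, sq_le_sq]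
  unfold roundToZero
  split_ifs with h
  · have h1 : 0 ≤ s * (n + 1) := by positivity
    have h2 : (0 : ℝ) ≤ (⌊s * (n + 1)⌋ : ℝ) := by exact_mod_cast Int.floor_nonneg.2 h1
    rw [abs_of_nonneg h2, abs_of_nonneg h1]
    exact Int.floor_le _
  · have h1 : s * (n + 1) ≤ 0 := mul_nonpos_of_nonpos_of_nonneg (not_le.1 h).le hn.le
    have h2 : (⌈s * (n + 1)⌉ : ℝ) ≤ 0 := by exact_mod_cast Int.ceil_le.2 (by simpa using h1)
    rw [abs_of_nonpos h2, abs_of_nonpos h1]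
    exact neg_le_neg (Int.le_ceil _)

theorem tendsto_roundToZero_div (s : ℝ) :
    Filter.Tendsto (fun n : ℕ => (roundToZero n s : ℝ) / (n + 1)) Filter.atTop (nhds s) := by
  have h : ∀ n : ℕ, |(roundToZero n s : ℝ) / (n + 1) - s| ≤ 1 / ((n : ℝ) + 1) := by
    intro n
    have hn : (0 : ℝ) < n + 1 := by positivity
    rw [show (roundToZero n s : ℝ) / (n + 1) - s = (roundToZero n s - s * (n + 1)) / (n + 1) by
      field_simp, abs_div, abs_of_pos hn]
    refine div_le_div_of_nonneg_right ?_ hn.le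
    unfold roundToZero
    split_ifs
    · have := Int.floor_le (s * (n + 1)); have := Int.lt_floor_add_one (s * (n + 1))
      rw [abs_le]; constructor <;> linarith
    · have := Int.le_ceil (s * (n + 1)); have := Int.ceil_lt_add_one (s * (n + 1))
      rw [abs_le]; constructor <;> linarith
  rw [tendsto_iff_dist_tendsto_zero]
  exact squeeze_zero (fun n => dist_nonneg) h tendsto_one_div_add_atTop_nhds_zero_nat

/-- The conditional sub-Gaussian bound at a random exponent `s` known before the noise: `s` is
approximated by countably-valued exponents that do not exceed it in absolute value. -/
theorem lintegral_mul_exp_le [IsProbabilityMeasure μ] (hm : m ≤ mΩ)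
    (hξ : CondSubGaussian μ m R ξ) (hξm : Measurable ξ)
    {s : Ω → ℝ} (hs : Measurable[m] s) {Z : Ω → ℝ≥0∞} (hZ : Measurable[m] Z) :
    ∫⁻ ω, Z ω * ENNReal.ofReal (Real.exp (s ω * ξ ω)) ∂μ ≤
      ∫⁻ ω, Z ω * ENNReal.ofReal (Real.exp (s ω ^ 2 * R ^ 2 / 2)) ∂μ := by
  have hZ' : Measurable Z := hZ.mono hm le_rfl
  have hs' : Measurable s := hs.mono hm le_rfl
  set N : ℕ → Ω → ℤ := fun n ω => roundToZero n (s ω) with hN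
  have hNm : ∀ n, Measurable[m] (N n) := fun n => (measurable_roundToZero n).comp hs
  have hNm' : ∀ n, Measurable (N n) := fun n => (hNm n).mono hm le_rfl
  have hcast : ∀ n, Measurable (fun ω => (N n ω : ℝ) / (n + 1)) := fun n =>
    ((measurable_from_top (f := fun z : ℤ => (z : ℝ))).comp (hNm' n)).div_const _
  have step (n : ℕ) : ∫⁻ ω, Z ω * ENNReal.ofReal (Real.exp ((N n ω : ℝ) / (n + 1) * ξ ω)) ∂μ ≤
      ∫⁻ ω, Z ω * ENNReal.ofReal (Real.exp (s ω ^ 2 * R ^ 2 / 2)) ∂μ := by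
    have hsplit (F : Ω → ℝ≥0∞) (hF : Measurable F) :
        ∫⁻ ω, F ω ∂μ = ∑' v : ℤ, ∫⁻ ω in N n ⁻¹' {v}, F ω ∂μ := by
      rw [← lintegral_iUnion (fun v => hNm' n (measurableSet_singleton v))
        (fun v w hvw => Set.disjoint_left.2 fun ω h1 h2 => hvw (h1.symm.trans h2)),
        ← Set.preimage_iUnion, Set.iUnion_of_singleton, Set.preimage_univ, Measure.restrict_univ]
    rw [hsplit _ (by fun_prop), hsplit _ (by fun_prop)]
    refine ENNReal.tsum_le_tsum fun v => ?_
    have hmv : MeasurableSet[m] (N n ⁻¹' {v}) := hNm n (measurableSet_singleton v)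
    have hmv' : MeasurableSet (N n ⁻¹' {v}) := hm _ hmv
    have hZv : Measurable[m] ((N n ⁻¹' {v}).indicator Z) := hZ.indicator hmv
    calc ∫⁻ ω in N n ⁻¹' {v}, Z ω * ENNReal.ofReal (Real.exp ((N n ω : ℝ) / (n + 1) * ξ ω)) ∂μ
        = ∫⁻ ω, (N n ⁻¹' {v}).indicator Z ω *
            ENNReal.ofReal (Real.exp ((v : ℝ) / (n + 1) * ξ ω)) ∂μ := by
          rw [← lintegral_indicator hmv']
          refine lintegral_congr fun ω => ?_
          by_cases h : ω ∈ N n ⁻¹' {v}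
          · rw [Set.indicator_of_mem h, Set.indicator_of_mem h, show N n ω = v from h]
          · rw [Set.indicator_of_notMem h, Set.indicator_of_notMem h, zero_mul]
      _ ≤ ENNReal.ofReal (Real.exp (((v : ℝ) / (n + 1)) ^ 2 * R ^ 2 / 2)) *
            ∫⁻ ω, (N n ⁻¹' {v}).indicator Z ω ∂μ := lintegral_mul_exp_const_le hm hξ _ hZv
      _ = ∫⁻ ω in N n ⁻¹' {v},
            ENNReal.ofReal (Real.exp (((v : ℝ) / (n + 1)) ^ 2 * R ^ 2 / 2)) * Z ω ∂μ := by
          rw [lintegral_indicator hmv', lintegral_const_mul _ hZ']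
      _ ≤ ∫⁻ ω in N n ⁻¹' {v}, Z ω * ENNReal.ofReal (Real.exp (s ω ^ 2 * R ^ 2 / 2)) ∂μ := by
          refine setLIntegral_mono (by fun_prop) fun ω hω => ?_
          rw [mul_comm, ← show N n ω = v from hω]
          gcongr Z ω * ENNReal.ofReal (Real.exp (?_ * R ^ 2 / 2))
          exact roundToZero_div_sq_le n (s ω)
  have hlim : ∀ ω, Filter.Tendsto
      (fun n : ℕ => Z ω * ENNReal.ofReal (Real.exp ((N n ω : ℝ) / (n + 1) * ξ ω))) Filter.atTop
      (nhds (Z ω * ENNReal.ofReal (Real.exp (s ω * ξ ω)))) := fun ω => by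
    refine ENNReal.Tendsto.const_mul (ENNReal.tendsto_ofReal ((Real.continuous_exp.tendsto _).comp
      ((tendsto_roundToZero_div (s ω)).mul_const _))) 
      (Or.inl (ENNReal.ofReal_pos.2 (Real.exp_pos _)).ne')
  calc ∫⁻ ω, Z ω * ENNReal.ofReal (Real.exp (s ω * ξ ω)) ∂μ
      = ∫⁻ ω, Filter.liminf (fun n : ℕ =>
          Z ω * ENNReal.ofReal (Real.exp ((N n ω : ℝ) / (n + 1) * ξ ω))) Filter.atTop ∂μ :=
        lintegral_congr fun ω => (hlim ω).liminf_eq.symm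
    _ ≤ Filter.liminf (fun n : ℕ =>
          ∫⁻ ω, Z ω * ENNReal.ofReal (Real.exp ((N n ω : ℝ) / (n + 1) * ξ ω)) ∂μ) Filter.atTop :=
        lintegral_liminf_le fun n => by have := hcast n; fun_prop
    _ ≤ _ := Filter.liminf_le_of_le (by isBoundedDefault) fun b hb => by
        obtain ⟨n, hn⟩ := hb.exists
        exact hn.trans (step n)

/-- Gaussian integral of the exponential of a square. -/
theorem lintegral_exp_sq_mul_gaussianPDFReal {v r : ℝ} (hv : 0 < v) (hr : r ^ 2 = (v - 1) / v)
    (b : ℝ) :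
    ∫⁻ z, ENNReal.ofReal (Real.exp ((b + z * r) ^ 2 / 2)) *
        ENNReal.ofReal (gaussianPDFReal 0 1 z) =
      ENNReal.ofReal (√v * Real.exp (v * b ^ 2 / 2)) := by
  have hpt : ∀ z, ENNReal.ofReal (Real.exp ((b + z * r) ^ 2 / 2)) *
      ENNReal.ofReal (gaussianPDFReal 0 1 z) = ENNReal.ofReal (√v * Real.exp (v * b ^ 2 / 2)) *
        ENNReal.ofReal (gaussianPDFReal (v * r * b) v.toNNReal z) := by
    intro z
    rw [← ENNReal.ofReal_mul (Real.exp_pos _).le, ← ENNReal.ofReal_mul (by positivity)]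
    congr 1
    simp only [gaussianPDFReal, NNReal.coe_one, Real.coe_toNNReal _ hv.le, mul_one, sub_zero]
    have hsv : √v ≠ 0 := (Real.sqrt_pos.2 hv).ne'
    rw [Real.sqrt_mul (by positivity) v, mul_inv]
    have hexp : Real.exp ((b + z * r) ^ 2 / 2) * Real.exp (-z ^ 2 / 2) =
        Real.exp (v * b ^ 2 / 2) * Real.exp (-(z - v * r * b) ^ 2 / (2 * v)) := by
      rw [← Real.exp_add, ← Real.exp_add]
      congr 1
      have hr' : v * r ^ 2 = v - 1 := by rw [hr]; field_simp
      field_simp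
      linear_combination (z ^ 2 + v * b ^ 2) * hr'
    calc _ = (√(2 * Real.pi))⁻¹ * (Real.exp ((b + z * r) ^ 2 / 2) * Real.exp (-z ^ 2 / 2)) := by
          ring
      _ = _ := by rw [hexp]; field_simp
  rw [lintegral_congr hpt, lintegral_const_mul _ (by fun_prop),
    lintegral_gaussianPDFReal_eq_one _ (by simpa using hv), mul_one]

theorem lintegral_exp_mul_gaussianPDFReal (t : ℝ) :
    ∫⁻ z, ENNReal.ofReal (Real.exp (t * z)) * ENNReal.ofReal (gaussianPDFReal 0 1 z) =
      ENNReal.ofReal (Real.exp (t ^ 2 / 2)) := by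
  have hpt : ∀ z, ENNReal.ofReal (Real.exp (t * z)) * ENNReal.ofReal (gaussianPDFReal 0 1 z) =
      ENNReal.ofReal (Real.exp (t ^ 2 / 2)) * ENNReal.ofReal (gaussianPDFReal t 1 z) := by
    intro z
    rw [← ENNReal.ofReal_mul (Real.exp_pos _).le, ← ENNReal.ofReal_mul (Real.exp_pos _).le]
    congr 1
    simp only [gaussianPDFReal]
    rw [mul_left_comm, mul_left_comm (Real.exp (t ^ 2 / 2)), ← Real.exp_add, ← Real.exp_add]
    congr 2
    simp; ring
  rw [lintegral_congr hpt, lintegral_const_mul _ (by fun_prop),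
    lintegral_gaussianPDFReal_eq_one _ one_ne_zero, mul_one]

/-- One step of the self-normalized supermartingale. The square `ξ²` in the exponent is linearized
by a Gaussian mixture, the sub-Gaussian bound is applied to every exponential in the mixture, and
the resulting Gaussian integral cancels the normalization exactly. -/
theorem lintegral_mul_selfNormalized_le [IsProbabilityMeasure μ] (hm : m ≤ mΩ)
    (hξ : CondSubGaussian μ m R ξ)
    (hξm : Measurable ξ) (hR : 0 < R) {a w : Ω → ℝ} (ha : Measurable[m] a) (hw : Measurable[m] w)
    (hw0 : ∀ ω, 0 ≤ w ω) {Z : Ω → ℝ≥0∞} (hZ : Measurable[m] Z) :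
    ∫⁻ ω, Z ω * ENNReal.ofReal ((√(1 + w ω))⁻¹ *
        Real.exp ((ξ ω ^ 2 - (ξ ω - a ω) ^ 2 / (1 + w ω)) / (2 * R ^ 2))) ∂μ ≤
      ∫⁻ ω, Z ω ∂μ := by
  set r : Ω → ℝ := fun ω => √(w ω / (1 + w ω)) with hr
  set b : Ω → ℝ := fun ω => a ω / ((1 + w ω) * R) with hb
  set Z' : Ω → ℝ≥0∞ := fun ω => Z ω * ENNReal.ofReal ((√(1 + w ω))⁻¹ *
    Real.exp (-((1 + w ω) * b ω ^ 2 / 2))) with hZ'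
  have hrm : Measurable[m] r := (hw.div (hw.const_add 1)).sqrt
  have hbm : Measurable[m] b := ha.div ((hw.const_add 1).mul_const R)
  have hZm : Measurable[m] Z' :=
    hZ.mul ((((hw.const_add 1).sqrt).inv.mul
      ((((hw.const_add 1).mul (hbm.pow_const 2)).div_const 2).neg.exp)).ennreal_ofReal)
  have hrm' := hrm.mono hm le_rfl
  have hbm' := hbm.mono hm le_rfl
  have hZm' := hZm.mono hm le_rfl
  have hr2 : ∀ ω, r ω ^ 2 = ((1 + w ω) - 1) / (1 + w ω) := fun ω => by
    have := hw0 ω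
    rw [hr, Real.sq_sqrt (by positivity), add_sub_cancel_left]
  have hpt : ∀ ω, Z ω * ENNReal.ofReal ((√(1 + w ω))⁻¹ *
        Real.exp ((ξ ω ^ 2 - (ξ ω - a ω) ^ 2 / (1 + w ω)) / (2 * R ^ 2))) =
      ∫⁻ z, Z' ω * ENNReal.ofReal (Real.exp ((b ω + z * r ω) / R * ξ ω)) *
        ENNReal.ofReal (gaussianPDFReal 0 1 z) := by
    intro ω
    have h1w : 0 < 1 + w ω := by have := hw0 ω; positivity
    have h1 : ∀ z, Z' ω * ENNReal.ofReal (Real.exp ((b ω + z * r ω) / R * ξ ω)) *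
        ENNReal.ofReal (gaussianPDFReal 0 1 z) =
        (Z' ω * ENNReal.ofReal (Real.exp (b ω / R * ξ ω))) *
          (ENNReal.ofReal (Real.exp (r ω * ξ ω / R * z)) *
            ENNReal.ofReal (gaussianPDFReal 0 1 z)) := by
      intro z
      rw [show (b ω + z * r ω) / R * ξ ω = b ω / R * ξ ω + r ω * ξ ω / R * z by ring, Real.exp_add,
        ENNReal.ofReal_mul (Real.exp_pos _).le]
      ring
    rw [lintegral_congr h1, lintegral_const_mul _ (by fun_prop), lintegral_exp_mul_gaussianPDFReal,
      hZ', mul_assoc, mul_assoc, ← ENNReal.ofReal_mul (Real.exp_pos _).le,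
      ← ENNReal.ofReal_mul (by positivity), mul_assoc, ← Real.exp_add, ← Real.exp_add]
    congr 4
    have e1 : (r ω * ξ ω / R) ^ 2 = w ω / (1 + w ω) * ξ ω ^ 2 / R ^ 2 := by
      rw [div_pow, mul_pow, hr2, add_sub_cancel_left]
    rw [e1, hb]
    field_simp
    ring
  have hjoint : Measurable fun q : Ω × ℝ =>
      Z' q.1 * ENNReal.ofReal (Real.exp ((b q.1 + q.2 * r q.1) / R * ξ q.1)) *
        ENNReal.ofReal (gaussianPDFReal 0 1 q.2) := by fun_prop
  have hjoint' : Measurable fun q : ℝ × Ω =>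
      Z' q.2 * ENNReal.ofReal (Real.exp (((b q.2 + q.1 * r q.2) / R) ^ 2 * R ^ 2 / 2)) *
        ENNReal.ofReal (gaussianPDFReal 0 1 q.1) := by fun_prop
  rw [lintegral_congr hpt, lintegral_lintegral_swap hjoint.aemeasurable]
  have hz : ∀ z, ∫⁻ ω, Z' ω * ENNReal.ofReal (Real.exp ((b ω + z * r ω) / R * ξ ω)) *
        ENNReal.ofReal (gaussianPDFReal 0 1 z) ∂μ ≤
      ∫⁻ ω, Z' ω * ENNReal.ofReal (Real.exp (((b ω + z * r ω) / R) ^ 2 * R ^ 2 / 2)) *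
        ENNReal.ofReal (gaussianPDFReal 0 1 z) ∂μ := by
    intro z
    rw [lintegral_mul_const _ (by fun_prop), lintegral_mul_const _ (by fun_prop)]
    gcongr ?_ * _
    exact lintegral_mul_exp_le hm hξ hξm ((hbm.add (hrm.const_mul z)).div_const R) hZm
  refine (lintegral_mono hz).trans ?_
  rw [lintegral_lintegral_swap hjoint'.aemeasurable]
  refine lintegral_mono fun ω => ?_
  have h1w : 0 < 1 + w ω := by have := hw0 ω; positivity
  have h2 : ∀ z, Z' ω * ENNReal.ofReal (Real.exp (((b ω + z * r ω) / R) ^ 2 * R ^ 2 / 2)) *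
        ENNReal.ofReal (gaussianPDFReal 0 1 z) =
      Z' ω * (ENNReal.ofReal (Real.exp ((b ω + z * r ω) ^ 2 / 2)) *
        ENNReal.ofReal (gaussianPDFReal 0 1 z)) := fun z => by
    rw [div_pow, div_mul_cancel₀ _ (by positivity), mul_assoc]
  rw [lintegral_congr h2, lintegral_const_mul _ (by fun_prop),
    lintegral_exp_sq_mul_gaussianPDFReal h1w (hr2 ω), hZ', mul_assoc,
    ← ENNReal.ofReal_mul (by positivity)]
  have h3 : (√(1 + w ω))⁻¹ * Real.exp (-((1 + w ω) * b ω ^ 2 / 2)) *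
      (√(1 + w ω) * Real.exp ((1 + w ω) * b ω ^ 2 / 2)) = 1 := by
    rw [Real.exp_neg]
    have := (Real.sqrt_pos.2 h1w).ne'
    field_simp
  rw [h3, ENNReal.ofReal_one, mul_one]

/-- Ville's maximal inequality for a nonnegative supermartingale up to time `N`, in a form that
keeps the mass left on the complement so that it can be proved by induction. -/
theorem mul_measure_exists_le_add_le {F : ℕ → MeasurableSpace Ω} (hF : ∀ n, F n ≤ mΩ)
    {M : ℕ → Ω → ℝ≥0∞} {N : ℕ} (hM : ∀ n ≤ N, ∀ j ≤ n, Measurable[F n] (M j))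
    (hstep : ∀ n < N, ∀ A, MeasurableSet[F n] A →
      ∫⁻ ω in A, M (n + 1) ω ∂μ ≤ ∫⁻ ω in A, M n ω ∂μ) (c : ℝ≥0∞) :
    ∀ n ≤ N, c * μ {ω | ∃ j ≤ n, c ≤ M j ω} + ∫⁻ ω in {ω | ∃ j ≤ n, c ≤ M j ω}ᶜ, M n ω ∂μ ≤
      ∫⁻ ω, M 0 ω ∂μ := by
  have hE : ∀ n ≤ N, MeasurableSet[F n] {ω | ∃ j ≤ n, c ≤ M j ω} := by
    intro n hn
    have : {ω | ∃ j ≤ n, c ≤ M j ω} = ⋃ j ∈ Set.Iic n, {ω | c ≤ M j ω} := by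
      ext ω; simp
    rw [this]
    exact MeasurableSet.biUnion (Set.to_countable _) fun j hj =>
      hM n hn j hj (measurableSet_Ici : MeasurableSet (Set.Ici c))
  intro n
  induction n with
  | zero =>
    intro _
    have e : {ω | ∃ j ≤ 0, c ≤ M j ω} = {ω | c ≤ M 0 ω} := by ext ω; simp
    have hm0 : Measurable (M 0) := (hM 0 (Nat.zero_le _) 0 le_rfl).mono (hF 0) le_rfl
    have hE0 : MeasurableSet {ω | c ≤ M 0 ω} :=
      hm0 (measurableSet_Ici : MeasurableSet (Set.Ici c))
    rw [e, ← lintegral_add_compl (μ := μ) (M 0) hE0]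
    refine add_le_add ?_ le_rfl
    rw [← setLIntegral_const]
    exact setLIntegral_mono hm0 fun ω hω => hω
  | succ n ih =>
    intro hn
    refine le_trans ?_ (ih (by omega))
    set E := {ω | ∃ j ≤ n, c ≤ M j ω} with hEdef
    set A := {ω | c ≤ M (n + 1) ω}
    have hmn : Measurable (M (n + 1)) := (hM (n + 1) hn _ le_rfl).mono (hF _) le_rfl
    have hA : MeasurableSet A := hmn (measurableSet_Ici : MeasurableSet (Set.Ici c))
    have hEm : MeasurableSet E := hF n _ (hE n (by omega))
    have e : {ω | ∃ j ≤ n + 1, c ≤ M j ω} = E ∪ (Eᶜ ∩ A) := by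
      ext ω
      simp only [Set.mem_ofPred_eq, Set.mem_union, Set.mem_inter_iff, Set.mem_compl_iff, hEdef, A]
      constructor
      · rintro ⟨j, hj, hc⟩
        by_cases h : ∃ j ≤ n, c ≤ M j ω
        · exact Or.inl h
        · rcases Nat.le_succ_iff.1 hj with h' | rfl
          · exact absurd ⟨j, h', hc⟩ h
          · exact Or.inr ⟨h, hc⟩
      · rintro (⟨j, hj, hc⟩ | ⟨_, hc⟩)
        · exact ⟨j, by omega, hc⟩
        · exact ⟨n + 1, le_rfl, hc⟩
    have e' : (E ∪ (Eᶜ ∩ A))ᶜ = Eᶜ \ A := by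
      ext ω; simp only [Set.mem_compl_iff, Set.mem_union, Set.mem_inter_iff, Set.mem_sdiff]; tauto
    rw [e, e']
    have h1 : μ (E ∪ (Eᶜ ∩ A)) ≤ μ E + μ (Eᶜ ∩ A) := measure_union_le _ _
    have h2 : c * μ (Eᶜ ∩ A) ≤ ∫⁻ ω in Eᶜ ∩ A, M (n + 1) ω ∂μ := by
      rw [← setLIntegral_const]
      exact setLIntegral_mono hmn fun ω hω => hω.2
    have h3 := lintegral_inter_add_sdiff (μ := μ) (M (n + 1)) Eᶜ hA
    have h4 := hstep n (by omega) Eᶜ (hE n (by omega)).compl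
    calc c * μ (E ∪ (Eᶜ ∩ A)) + ∫⁻ ω in Eᶜ \ A, M (n + 1) ω ∂μ
        ≤ c * (μ E + μ (Eᶜ ∩ A)) + ∫⁻ ω in Eᶜ \ A, M (n + 1) ω ∂μ := by gcongr
      _ ≤ c * μ E + (∫⁻ ω in Eᶜ ∩ A, M (n + 1) ω ∂μ + ∫⁻ ω in Eᶜ \ A, M (n + 1) ω ∂μ) := by
          rw [mul_add, add_assoc]; gcongr
      _ ≤ c * μ E + ∫⁻ ω in Eᶜ, M n ω ∂μ := by rw [h3]; gcongr

/-- A conditionally `0`-sub-Gaussian variable vanishes almost surely. -/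
theorem ae_eq_zero_of_condSubGaussian_zero [IsProbabilityMeasure μ] (hm : m ≤ mΩ)
    (hξ : CondSubGaussian μ m 0 ξ) :
    ∀ᵐ ω ∂μ, ξ ω = 0 := by
  have h (s : ℝ) : ∫ ω, Real.exp (s * ξ ω) ∂μ ≤ 1 := by
    rw [← integral_condExp hm]
    refine (integral_mono_ae integrable_condExp (integrable_const _) (hξ s).2).trans ?_
    simp
  have hi1 := (hξ 1).1
  have hi2 := (hξ (-1)).1
  have hi12 : Integrable (fun ω => Real.exp (1 * ξ ω) + Real.exp (-1 * ξ ω)) μ := hi1.add hi2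
  have hnn : 0 ≤ fun ω => (Real.exp (1 * ξ ω) + Real.exp (-1 * ξ ω)) - 2 := fun ω => by
    have h1 := Real.one_le_cosh (ξ ω)
    rw [Real.cosh_eq] at h1
    simp only [Pi.zero_apply, one_mul, neg_mul]
    linarith
  have hint : Integrable (fun ω => (Real.exp (1 * ξ ω) + Real.exp (-1 * ξ ω)) - 2) μ :=
    hi12.sub (integrable_const _)
  have hzero : ∫ ω, ((Real.exp (1 * ξ ω) + Real.exp (-1 * ξ ω)) - 2) ∂μ = 0 := by
    refine le_antisymm ?_ (integral_nonneg hnn)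
    rw [integral_sub hi12 (integrable_const _), integral_add hi1 hi2]
    have := h 1
    have := h (-1)
    simp only [integral_const, probReal_univ, one_smul]
    linarith
  filter_upwards [(integral_eq_zero_iff_of_nonneg hnn hint).1 hzero] with ω hω
  by_contra hne
  have h1 := (Real.one_lt_cosh (x := ξ ω)).2 hne
  rw [Real.cosh_eq] at h1
  simp only [Pi.zero_apply, one_mul, neg_mul] at hω
  linarith

end Noise

/-! ### The self-normalized bound on every block -/

section SelfNormalized

open scoped ENNReal

variable {X : Type*} {H : Type*} [NormedAddCommGroup H] [InnerProductSpace ℝ H]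
  [CompleteSpace H] [RKHS ℝ H X ℝ] {Ω : Type*} {mΩ : MeasurableSpace Ω} {μ : Measure Ω}
  {ℱ : Filtration ℕ mΩ} {x : ℕ → Ω → X} {ξ : ℕ → Ω → ℝ}

/-- A function of finitely many queries and noise terms that is continuous in the noise is
measurable, since the queries range over a finite set. -/
theorem measurable_of_queries_noise [Finite X] {m : MeasurableSpace Ω} {n n' : ℕ}
    {xs : Ω → Fin n → X} {ys : Ω → Fin n' → ℝ} (hxs : ∀ i, Measurable[m, ⊤] fun ω => xs ω i)
    (hys : ∀ i, Measurable[m] fun ω => ys ω i) (F : (Fin n → X) → (Fin n' → ℝ) → ℝ)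
    (hF : ∀ p, Continuous (F p)) : Measurable[m] fun ω => F (xs ω) (ys ω) := by
  let _ : MeasurableSpace X := ⊤
  have h1 : Measurable[m] xs := measurable_pi_iff.2 hxs
  have h2 : Measurable[m] ys := measurable_pi_iff.2 hys
  exact (measurable_from_prod_countable_right (f := fun q : (Fin n → X) × (Fin n' → ℝ) => F q.1 q.2)
    fun p => (hF p).measurable).comp (h1.prodMk h2)

theorem continuous_postMean (k : X → X → ℝ) (lam : ℝ) {n : ℕ} (xs : Fin n → X) (z : X) :
    Continuous fun y => postMean k lam xs y z := by
  unfold postMean; fun_prop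

theorem continuous_noiseEnergy (k : X → X → ℝ) (lam : ℝ) {n : ℕ} (xs : Fin n → X) :
    Continuous fun y => noiseEnergy k lam xs y := by
  unfold noiseEnergy; fun_prop

/-- The self-normalized process of the `n` observations from time `a` on. -/
noncomputable def selfNormalized (k : X → X → ℝ) (lam R : ℝ) (x : ℕ → Ω → X) (ξ : ℕ → Ω → ℝ)
    (a n : ℕ) (ω : Ω) : ℝ :=
  (√(infoDet k lam fun i : Fin n => x (a + i) ω))⁻¹ *
    Real.exp (noiseEnergy k lam (fun i : Fin n => x (a + i) ω) (fun i => ξ (a + i) ω) /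
      (2 * R ^ 2))

theorem selfNormalized_succ {lam : ℝ} (hlam : 0 < lam) (R : ℝ) (x : ℕ → Ω → X) (ξ : ℕ → Ω → ℝ)
    (a n : ℕ) (ω : Ω) :
    selfNormalized (scalarKernel H) lam R x ξ a (n + 1) ω =
      selfNormalized (scalarKernel H) lam R x ξ a n ω *
      ((√(1 + postVar (scalarKernel H) lam (fun i : Fin n => x (a + i) ω) (x (a + n) ω) / lam))⁻¹ *
        Real.exp ((ξ (a + n) ω ^ 2 - (ξ (a + n) ω - postMean (scalarKernel H) lam
          (fun i : Fin n => x (a + i) ω) (fun i => ξ (a + i) ω) (x (a + n) ω)) ^ 2 /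
          (1 + postVar (scalarKernel H) lam (fun i : Fin n => x (a + i) ω) (x (a + n) ω) / lam)) /
            (2 * R ^ 2))) := by
  have h1 := one_le_infoDet (H := H) hlam (fun i : Fin n => x (a + i) ω)
  have e1 := infoDet_succ (H := H) hlam (fun i : Fin (n + 1) => x (a + i) ω)
  have e2 := noiseEnergy_succ (H := H) hlam (fun i : Fin (n + 1) => x (a + i) ω)
    (fun i => ξ (a + i) ω)
  simp only [Fin.val_last] at e1 e2
  change _ = infoDet (scalarKernel H) lam (fun i : Fin n => x (a + i) ω) *
    (1 + postVar (scalarKernel H) lam (fun i : Fin n => x (a + i) ω) (x (a + n) ω) / lam) at e1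
  change _ = noiseEnergy (scalarKernel H) lam (fun i : Fin n => x (a + i) ω)
    (fun i => ξ (a + i) ω) + ξ (a + n) ω ^ 2 - (ξ (a + n) ω - postMean (scalarKernel H) lam
      (fun i : Fin n => x (a + i) ω) (fun i => ξ (a + i) ω) (x (a + n) ω)) ^ 2 /
      (1 + postVar (scalarKernel H) lam (fun i : Fin n => x (a + i) ω) (x (a + n) ω) / lam) at e2
  rw [selfNormalized, selfNormalized, e1, e2, Real.sqrt_mul (by positivity), mul_inv, add_sub_assoc,
    add_div, Real.exp_add]
  ring

/-- Predictable queries together with one adapted, conditionally `R`-sub-Gaussian noise sequence.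
The queries may depend on further randomness, such as the other noise sequence. -/
structure NoiseModel (μ : Measure Ω) (ℱ : Filtration ℕ mΩ) (R : ℝ) (T : ℕ) (x : ℕ → Ω → X)
    (ξ : ℕ → Ω → ℝ) : Prop where
  query_meas : ∀ t ∈ Finset.Icc 1 T, Measurable[ℱ (t - 1), ⊤] (x t)
  noise_meas : ∀ t ∈ Finset.Icc 1 T, Measurable[ℱ t] (ξ t)
  subGaussian : ∀ t ∈ Finset.Icc 1 T, CondSubGaussian μ (ℱ (t - 1)) R (ξ t)

namespace NoiseModel

variable {R : ℝ} {T : ℕ}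

theorem query_meas_of_lt (h : NoiseModel μ ℱ R T x ξ) {t s : ℕ} (ht : t ∈ Finset.Icc 1 T)
    (hs : t - 1 ≤ s) : Measurable[ℱ s, ⊤] (x t) := fun _ hA => ℱ.mono hs _ (h.query_meas t ht hA)

theorem noise_meas_of_le (h : NoiseModel μ ℱ R T x ξ) {t s : ℕ} (ht : t ∈ Finset.Icc 1 T)
    (hs : t ≤ s) : Measurable[ℱ s] (ξ t) := (h.noise_meas t ht).mono (ℱ.mono hs) le_rfl

theorem measurable_selfNormalized [Finite X] (h : NoiseModel μ ℱ R T x ξ) (k : X → X → ℝ) (lam : ℝ)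
    {a j n : ℕ} (ha : 1 ≤ a) (hj : j ≤ n) (hn : a + n ≤ T) :
    Measurable[ℱ (a + n - 1)] (selfNormalized k lam R x ξ a j) := by
  have hmem (i : Fin j) : a + i ∈ Finset.Icc 1 T := Finset.mem_Icc.2 ⟨by omega, by omega⟩
  refine measurable_of_queries_noise (fun i => h.query_meas_of_lt (hmem i) (by omega))
    (fun i => h.noise_meas_of_le (hmem i) (by omega))
    (fun xs ys => (√(infoDet k lam xs))⁻¹ * Real.exp (noiseEnergy k lam xs ys / (2 * R ^ 2)))
    fun xs => ?_
  have := continuous_noiseEnergy k lam xs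
  fun_prop

theorem setLIntegral_selfNormalized_succ_le [Finite X] [IsProbabilityMeasure μ]
    (h : NoiseModel μ ℱ R T x ξ) (hR : 0 < R) {lam : ℝ}
    (hlam : 0 < lam) {a n : ℕ} (ha : 1 ≤ a) (hn : a + n ≤ T) {A : Set Ω}
    (hA : MeasurableSet[ℱ (a + n - 1)] A) :
    ∫⁻ ω in A, ENNReal.ofReal (selfNormalized (scalarKernel H) lam R x ξ a (n + 1) ω) ∂μ ≤
      ∫⁻ ω in A, ENNReal.ofReal (selfNormalized (scalarKernel H) lam R x ξ a n ω) ∂μ := by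
  have hmem : a + n ∈ Finset.Icc 1 T := Finset.mem_Icc.2 ⟨by omega, hn⟩
  have hm := ℱ.le (a + n - 1)
  have hmemi (i : Fin n) : a + i ∈ Finset.Icc 1 T := Finset.mem_Icc.2 ⟨by omega, by omega⟩
  have hq : ∀ i : Fin (n + 1), Measurable[ℱ (a + n - 1), ⊤] (x (a + i)) := fun i =>
    h.query_meas_of_lt (Finset.mem_Icc.2 ⟨by omega, by omega⟩) (by omega)
  have hmean : Measurable[ℱ (a + n - 1)] fun ω => postMean (scalarKernel H) lam
      (fun i : Fin n => x (a + i) ω) (fun i => ξ (a + i) ω) (x (a + n) ω) :=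
    measurable_of_queries_noise (xs := fun ω (i : Fin (n + 1)) => x (a + i) ω)
      (ys := fun ω (i : Fin n) => ξ (a + i) ω) hq (fun i => h.noise_meas_of_le (hmemi i) (by omega))
      (fun xs ys => postMean (scalarKernel H) lam (fun i : Fin n => xs i.castSucc) ys
        (xs (Fin.last n))) fun xs => continuous_postMean _ _ _ _
  have hvar : Measurable[ℱ (a + n - 1)] fun ω => postVar (scalarKernel H) lam
      (fun i : Fin n => x (a + i) ω) (x (a + n) ω) / lam :=
    measurable_of_queries_noise (xs := fun ω (i : Fin (n + 1)) => x (a + i) ω)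
      (ys := fun ω (i : Fin n) => ξ (a + i) ω) hq (fun i => h.noise_meas_of_le (hmemi i) (by omega))
      (fun xs _ => postVar (scalarKernel H) lam (fun i : Fin n => xs i.castSucc)
        (xs (Fin.last n)) / lam) fun xs => continuous_const
  have hM := (h.measurable_selfNormalized (scalarKernel H) lam ha le_rfl hn).ennreal_ofReal
  rw [← lintegral_indicator (hm _ hA), ← lintegral_indicator (hm _ hA)]
  refine le_of_eq_of_le (lintegral_congr fun ω => ?_)
    (lintegral_mul_selfNormalized_le hm (h.subGaussian _ hmem)
      ((h.noise_meas _ hmem).mono (ℱ.le _) le_rfl) hR hmean hvar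
      (fun ω => div_nonneg (postVar_nonneg hlam _ _) hlam.le) (hM.indicator hA))
  by_cases hω : ω ∈ A
  · rw [Set.indicator_of_mem hω, Set.indicator_of_mem hω, selfNormalized_succ hlam,
      ENNReal.ofReal_mul (by unfold selfNormalized; positivity)]
  · rw [Set.indicator_of_notMem hω, Set.indicator_of_notMem hω, zero_mul]

/-- Noise energy bound, uniformly over the times `a, …, T`. -/
theorem measure_exists_noiseEnergy_gt_le [Finite X] [IsProbabilityMeasure μ]
    (h : NoiseModel μ ℱ R T x ξ) (hR : 0 ≤ R) {lam : ℝ}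
    (hlam : 0 < lam) {δ : ℝ} (hδ : 0 < δ) {a : ℕ} (ha : 1 ≤ a) (haT : a ≤ T) :
    μ {ω | ∃ n ≤ T - a, R ^ 2 * (2 * Real.log (1 / δ) +
        Real.log (infoDet (scalarKernel H) lam fun i : Fin n => x (a + i) ω)) <
      noiseEnergy (scalarKernel H) lam (fun i : Fin n => x (a + i) ω) (fun i => ξ (a + i) ω)} ≤
      ENNReal.ofReal δ := by
  rcases hR.eq_or_lt with rfl | hR
  · have h0 : ∀ᵐ ω ∂μ, ∀ t ∈ Finset.Icc 1 T, ξ t ω = 0 :=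
      (Filter.eventually_all_finset _).2 fun t ht =>
        ae_eq_zero_of_condSubGaussian_zero (ℱ.le _) (h.subGaussian t ht)
    refine le_of_eq_of_le (measure_mono_null ?_ h0) zero_le
    rintro ω ⟨n, hn, hlt⟩ hω
    have : (fun i : Fin n => ξ (a + i) ω) = 0 := funext fun i =>
      hω _ (Finset.mem_Icc.2 ⟨by omega, by omega⟩)
    rw [this] at hlt
    simp [noiseEnergy] at hlt
  · have hville := mul_measure_exists_le_add_le (μ := μ) (F := fun n => ℱ (a + n - 1))
      (fun n => ℱ.le _)
      (M := fun n ω => ENNReal.ofReal (selfNormalized (scalarKernel H) lam R x ξ a n ω))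
      (N := T - a)
      (fun n hn j hj => (h.measurable_selfNormalized _ lam ha hj (by omega)).ennreal_ofReal)
      (fun n hn A hA => h.setLIntegral_selfNormalized_succ_le hR hlam ha (by omega) hA)
      (ENNReal.ofReal (1 / δ)) (T - a) le_rfl
    have hinit : ∫⁻ ω, ENNReal.ofReal (selfNormalized (scalarKernel H) lam R x ξ a 0 ω) ∂μ = 1 := by
      simp [selfNormalized, infoDet, noiseEnergy]
    rw [hinit] at hville
    have hville := le_self_add.trans hville
    have hbound : μ {ω | ∃ n ≤ T - a, ENNReal.ofReal (1 / δ) ≤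
        ENNReal.ofReal (selfNormalized (scalarKernel H) lam R x ξ a n ω)} ≤ ENNReal.ofReal δ := by
      calc _ = ENNReal.ofReal δ * (ENNReal.ofReal (1 / δ) * μ {ω | ∃ n ≤ T - a,
            ENNReal.ofReal (1 / δ) ≤
              ENNReal.ofReal (selfNormalized (scalarKernel H) lam R x ξ a n ω)}) := by
            rw [← mul_assoc, ← ENNReal.ofReal_mul hδ.le, mul_one_div_cancel hδ.ne',
              ENNReal.ofReal_one, one_mul]
        _ ≤ ENNReal.ofReal δ * 1 := by gcongr
        _ = ENNReal.ofReal δ := mul_one _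
    refine (measure_mono ?_).trans hbound
    rintro ω ⟨n, hn, hlt⟩
    refine ⟨n, hn, ENNReal.ofReal_le_ofReal ?_⟩
    have hdet := one_le_infoDet (H := H) hlam (fun i : Fin n => x (a + i) ω)
    rw [selfNormalized]
    set d := infoDet (scalarKernel H) lam fun i : Fin n => x (a + i) ω
    set E := noiseEnergy (scalarKernel H) lam (fun i : Fin n => x (a + i) ω)
      (fun i => ξ (a + i) ω)
    have hd : 0 < d := by linarith
    have h1 : Real.log (1 / δ) + Real.log d / 2 ≤ E / (2 * R ^ 2) := by
      rw [le_div_iff₀ (by positivity)]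
      linarith
    have h2 := Real.exp_le_exp.2 h1
    rw [Real.exp_add, Real.exp_log (by positivity), Real.exp_half, Real.exp_log hd] at h2
    rw [inv_mul_eq_div, le_div_iff₀ (Real.sqrt_pos.2 hd)]
    exact h2

/-- The noise is controlled at all times, up to a failure probability `δ` for every block. -/
theorem measure_not_noiseControlled_le [Finite X] [IsProbabilityMeasure μ] (p : Params)
    (h : NoiseModel μ ℱ p.R p.T x ξ)
    (hR : 0 ≤ p.R) (hlam : 0 < p.lam) (hδ : 0 < p.delta) (hW : 0 < p.W) :
    μ {ω | ∃ t ∈ Finset.Icc 1 p.T, ¬ NoiseControlled (scalarKernel H) p (fun t => x t ω)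
      (fun t => ξ t ω) t} ≤ (⌈(p.T : ℝ) / p.W⌉₊ : ℝ≥0∞) * ENNReal.ofReal p.delta := by
  set E : ℕ → Set Ω := fun j => {ω | j * p.W + 1 ≤ p.T ∧ ∃ n ≤ p.T - (j * p.W + 1),
    p.R ^ 2 * (2 * Real.log (1 / p.delta) + Real.log (infoDet (scalarKernel H) p.lam
      fun i : Fin n => x (j * p.W + 1 + i) ω)) <
    noiseEnergy (scalarKernel H) p.lam (fun i : Fin n => x (j * p.W + 1 + i) ω)
      (fun i => ξ (j * p.W + 1 + i) ω)}
  have hE : ∀ j, μ (E j) ≤ ENNReal.ofReal p.delta := by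
    intro j
    by_cases hj : j * p.W + 1 ≤ p.T
    · refine (measure_mono ?_).trans
        (h.measure_exists_noiseEnergy_gt_le (H := H) hR hlam hδ (Nat.le_add_left _ _) hj)
      exact fun ω hω => hω.2
    · rw [show E j = ∅ from Set.eq_empty_of_forall_notMem fun ω hω => hj hω.1]
      simp
  calc _ ≤ μ (⋃ j ∈ Finset.range ⌈(p.T : ℝ) / p.W⌉₊, E j) := by
        refine measure_mono ?_
        rintro ω ⟨t, ht, hω⟩
        rw [Finset.mem_Icc] at ht
        have hle := blockStart_le p.W ht.1
        rw [Set.mem_iUnion₂]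
        refine ⟨(t - 1) / p.W, ?_, ?_, t - blockStart p.W t, ?_, not_le.1 hω⟩
        · rw [Finset.mem_range, Nat.lt_ceil, lt_div_iff₀ (by exact_mod_cast hW)]
          have := Nat.div_mul_le_self (t - 1) p.W
          exact_mod_cast (by omega : (t - 1) / p.W * p.W < p.T)
        · exact hle.trans ht.2
        · change t - blockStart p.W t ≤ p.T - blockStart p.W t
          omega
    _ ≤ ∑ j ∈ Finset.range ⌈(p.T : ℝ) / p.W⌉₊, μ (E j) := measure_biUnion_finset_le _ _
    _ ≤ ∑ _j ∈ Finset.range ⌈(p.T : ℝ) / p.W⌉₊, ENNReal.ofReal p.delta :=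
        Finset.sum_le_sum fun j _ => hE j
    _ = _ := by simp

end NoiseModel

end SelfNormalized

/-! ### Optimism of the algorithm -/

section Optimism

variable {X : Type*} [Finite X] {H : Type*} [NormedAddCommGroup H] [InnerProductSpace ℝ H]
  [CompleteSpace H] [RKHS ℝ H X ℝ] {p : Params} {b : ℝ} {h : ℕ → H} {x : ℕ → X} {ξ : ℕ → ℝ} {t : ℕ}

/-- The error caused by the variation of the unknown function since the last restart. -/
noncomputable def driftError (p : Params) (h : ℕ → H) (t : ℕ) : ℝ :=
  √(p.W / p.lam) * blockDrift p.W (fun s => ‖h (s + 1) - h s‖) t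

theorem driftError_nonneg {H : Type*} [NormedAddCommGroup H] (p : Params) (h : ℕ → H) (t : ℕ) :
    0 ≤ driftError p h t :=
  mul_nonneg (Real.sqrt_nonneg _) (blockDrift_nonneg _ (fun _ => norm_nonneg _) _)

theorem confWidth_nonneg {X : Type*} (k : X → X → ℝ) (hR : 0 ≤ p.R) (hb : 0 ≤ b) (n : ℕ) :
    0 ≤ confWidth k p b n := by
  unfold confWidth; positivity

/-- The optimistic reward estimate lies above the reward up to the drift, and exceeds it by at most
the width of the confidence interval plus the drift. -/
theorem optimism_fHat (hlam : 0 < p.lam) (hR : 0 ≤ p.R) (hW : 0 < p.W) (hB : 0 ≤ p.B)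
    (hk : ∀ x : X, scalarKernel H x x ≤ 1) (ht : 1 ≤ t) (hb : ‖h t‖ ≤ p.B)
    (hξ : NoiseControlled (scalarKernel H) p x ξ t) (z : X) :
    h t z ≤ fHat (scalarKernel H) p x (fun s => h s (x s) + ξ s) t z + driftError p h t ∧
    fHat (scalarKernel H) p x (fun s => h s (x s) + ξ s) t z ≤
      h t z + 2 * (confWidth (scalarKernel H) p p.B (t - blockStart p.W t) *
        √(postVar (scalarKernel H) p.lam (window p.W t x) z)) + driftError p h t := by
  have h1 := abs_le.1 (abs_sub_postMean_window_le hlam hR hW hk h x ξ ht hb hξ z)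
  change -(_ + driftError p h t) ≤ _ ∧ _ ≤ _ + driftError p h t at h1
  have h2 := abs_le.1 ((abs_apply_le (h t) z (hk z)).trans hb)
  have h3 := driftError_nonneg p h t
  have h4 := mul_nonneg (confWidth_nonneg (scalarKernel H) hR hB (t - blockStart p.W t))
    (Real.sqrt_nonneg (postVar (scalarKernel H) p.lam (window p.W t x) z))
  exact ⟨le_clamp h3 h2.2 (by linarith), clamp_le (by linarith) (by linarith)⟩

/-- The constraint estimate is optimistic in the opposite direction: it lies below the constraint
function up to the drift. -/
theorem optimism_gHat (hlam : 0 < p.lam) (hR : 0 ≤ p.R) (hW : 0 < p.W) (hG : 0 ≤ p.G)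
    (hk : ∀ x : X, scalarKernel H x x ≤ 1) (ht : 1 ≤ t) (hb : ‖h t‖ ≤ p.G)
    (hξ : NoiseControlled (scalarKernel H) p x ξ t) (z : X) :
    gHat (scalarKernel H) p x (fun s => h s (x s) + ξ s) t z ≤ h t z + driftError p h t ∧
    h t z ≤ gHat (scalarKernel H) p x (fun s => h s (x s) + ξ s) t z +
      2 * (confWidth (scalarKernel H) p p.G (t - blockStart p.W t) *
        √(postVar (scalarKernel H) p.lam (window p.W t x) z)) + driftError p h t := by
  have h1 := abs_le.1 (abs_sub_postMean_window_le hlam hR hW hk h x ξ ht hb hξ z)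
  change -(_ + driftError p h t) ≤ _ ∧ _ ≤ _ + driftError p h t at h1
  have h2 := abs_le.1 ((abs_apply_le (h t) z (hk z)).trans hb)
  have h3 := driftError_nonneg p h t
  have h4 := mul_nonneg (confWidth_nonneg (scalarKernel H) hR hG (t - blockStart p.W t))
    (Real.sqrt_nonneg (postVar (scalarKernel H) p.lam (window p.W t x) z))
  refine ⟨clamp_le (by linarith) (by linarith), ?_⟩
  rw [add_assoc]
  exact le_clamp (by positivity) h2.2 (by linarith)

/-- The width of the confidence interval at the query of time `t`. -/
noncomputable def queryWidth (k : X → X → ℝ) (p : Params) (b : ℝ) (x : ℕ → X) (t : ℕ) : ℝ :=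
  2 * (confWidth k p b (t - blockStart p.W t) * √(queryVar k p.lam p.W x t))

theorem queryWidth_nonneg {X : Type*} (k : X → X → ℝ) (hR : 0 ≤ p.R) (hb : 0 ≤ b) (x : ℕ → X)
    (t : ℕ) : 0 ≤ queryWidth k p b x t :=
  mul_nonneg zero_le_two (mul_nonneg (confWidth_nonneg k hR hb _) (Real.sqrt_nonneg _))

/-- Together with `W ~ γ^(1/4) T^(1/2)` this makes the total drift of order
`γ^(3/8) T^(3/4)` times the variation budget. -/
theorem sum_driftError_le {H : Type*} [NormedAddCommGroup H] (hW : 0 < p.W) (h : ℕ → H) {V : ℝ}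
    (hV : ∑ t ∈ Finset.Ico 1 p.T, ‖h (t + 1) - h t‖ ≤ V) :
    ∑ t ∈ Finset.Icc 1 p.T, driftError p h t ≤ √(p.W / p.lam) * p.W * V := by
  unfold driftError
  rw [← Finset.mul_sum, mul_assoc]
  refine mul_le_mul_of_nonneg_left ?_ (Real.sqrt_nonneg _)
  exact (sum_blockDrift_le hW (fun _ => norm_nonneg _) _).trans
    (mul_le_mul_of_nonneg_left hV (Nat.cast_nonneg _))

theorem sum_queryWidth_le [Nonempty X] (hlam : 0 < p.lam) (hR : 0 ≤ p.R)
    (hk : ∀ x : X, scalarKernel H x x ≤ 1) (hT : 1 ≤ p.T) {b b' γ : ℝ} (hb : 0 ≤ b) (hbb : b ≤ b')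
    (hγ : maxInfoGain (scalarKernel H) p.lam p.T ≤ γ) (x : ℕ → X) :
    ∑ t ∈ Finset.Icc 1 p.T, queryWidth (scalarKernel H) p b x t ≤
      2 * ((b' + 1 / √p.lam * p.R * √(2 * Real.log (1 / p.delta) + 2 * γ)) *
        √(p.T * ((p.lam + 1) * (2 * γ * (p.T / p.W + 1))))) := by
  unfold queryWidth
  rw [← Finset.mul_sum]
  refine mul_le_mul_of_nonneg_left ?_ zero_le_two
  have h1 : ∀ t ∈ Finset.Icc 1 p.T, confWidth (scalarKernel H) p b (t - blockStart p.W t) ≤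
      b' + 1 / √p.lam * p.R * √(2 * Real.log (1 / p.delta) + 2 * γ) := by
    intro t ht
    rw [Finset.mem_Icc] at ht
    have h2 := maxInfoGain_mono (H := H) hlam (a := t - blockStart p.W t) (b := p.T) (by omega)
    unfold confWidth
    gcongr
    linarith
  calc _ ≤ ∑ t ∈ Finset.Icc 1 p.T,
        (b' + 1 / √p.lam * p.R * √(2 * Real.log (1 / p.delta) + 2 * γ)) *
          √(queryVar (scalarKernel H) p.lam p.W x t) :=
        Finset.sum_le_sum fun t ht => mul_le_mul_of_nonneg_right (h1 t ht) (Real.sqrt_nonneg _)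
    _ ≤ _ := by
        rw [← Finset.mul_sum]
        have hb' : 0 ≤ b' := hb.trans hbb
        refine mul_le_mul_of_nonneg_left ?_ (by positivity)
        refine (sum_sqrt_queryVar_le hlam hk p.W x hT).trans ?_
        gcongr

/-- On controlled noise, a run of the algorithm is a primal-dual run on optimistic estimates. -/
theorem optimisticRun {H' : Type*} [NormedAddCommGroup H'] [InnerProductSpace ℝ H']
    [CompleteSpace H'] [RKHS ℝ H' X ℝ] {f : ℕ → H} {g : ℕ → H'} {n n' φ : ℕ → ℝ}
    (hlam : 0 < p.lam) (hR : 0 ≤ p.R) (hW : 0 < p.W) (hB : 0 < p.B) (hG : 0 < p.G)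
    (hρ : 0 < p.rho) (hT : 1 ≤ p.T)
    (hk : ∀ x : X, scalarKernel H x x ≤ 1) (hk' : ∀ x : X, scalarKernel H' x x ≤ 1)
    (hf : ∀ t ∈ Finset.Icc 1 p.T, ‖f t‖ ≤ p.B) (hg : ∀ t ∈ Finset.Icc 1 p.T, ‖g t‖ ≤ p.G)
    (hn : ∀ t ∈ Finset.Icc 1 p.T, NoiseControlled (scalarKernel H) p x n t)
    (hn' : ∀ t ∈ Finset.Icc 1 p.T, NoiseControlled (scalarKernel H') p x n' t)
    (hrun : IsRun (scalarKernel H) (scalarKernel H') p x (fun t => f t (x t) + n t)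
      (fun t => g t (x t) + n' t) φ) :
    OptimisticRun (fun t => f t) (fun t => g t)
      (fHat (scalarKernel H) p x (fun t => f t (x t) + n t))
      (gHat (scalarKernel H') p x (fun t => g t (x t) + n' t)) x φ
      (driftError p f) (driftError p g) (queryWidth (scalarKernel H) p p.B x)
      (queryWidth (scalarKernel H') p p.G x) p.B p.G p.rho p.T := by
  have hpos : ∀ t ∈ Finset.Icc 1 p.T, 1 ≤ t := fun t ht => (Finset.mem_Icc.1 ht).1
  exact
  { B_pos := hB
    G_pos := hG
    rho_pos := hρ
    T_pos := hT
    dual_init := hrun.dual_init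
    select := hrun.select
    dual_step := hrun.dual_step
    reward_bound := fun t _ z => abs_clamp_le hB.le
    constraint_bound := fun t _ z => abs_clamp_le hG.le
    drift_nonneg := fun t _ => driftError_nonneg _ _ _
    reward_le := fun t ht z =>
      (optimism_fHat hlam hR hW hB.le hk (hpos t ht) (hf t ht) (hn t ht) z).1
    le_reward := fun t ht =>
      (optimism_fHat hlam hR hW hB.le hk (hpos t ht) (hf t ht) (hn t ht) _).2
    le_constraint := fun t ht z =>
      (optimism_gHat hlam hR hW hG.le hk' (hpos t ht) (hg t ht) (hn' t ht) z).1
    constraint_le := fun t ht =>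
      (optimism_gHat hlam hR hW hG.le hk' (hpos t ht) (hg t ht) (hn' t ht) _).2 }

/-- The Slater condition forces a constraint kernel with a large diagonal entry. -/
theorem exists_sq_div_sq_le_scalarKernel [Fintype X] [Nonempty X] {g : H} {G τ : ℝ} (hG : 0 < G)
    (hτ : 0 < τ) (hg : ‖g‖ ≤ G) (hS : ∃ π ∈ stdSimplex ℝ X, policyMean π g ≤ -τ) :
    ∃ z : X, τ ^ 2 / G ^ 2 ≤ scalarKernel H z z := by
  obtain ⟨π, hπ, hπg⟩ := hS
  obtain ⟨z, hz⟩ := Finite.exists_min (fun z => g z)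
  refine ⟨z, ?_⟩
  have h1 : g z ≤ -τ := by
    rw [← policyMean_const hπ (g z)]
    exact (policyMean_mono hπ hz).trans hπg
  have h2 := sq_apply_le g z
  have hk : 0 ≤ scalarKernel H z z := by rw [scalarKernel_self]; positivity
  rw [div_le_iff₀ (by positivity)]
  have h3 : ‖g‖ ^ 2 * scalarKernel H z z ≤ G ^ 2 * scalarKernel H z z := by gcongr
  nlinarith

end Optimism

/-! ### Rates -/

/-- If `γ` grows at least logarithmically in `T`, then `log (1 / δ)` is of order `γ`. -/
theorem log_inv_le_mul {a δ₀ δ T γ : ℝ} (ha : 0 < a) (hδ₀ : 0 < δ₀) (hT : 1 ≤ T)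
    (hlog : Real.log (1 + T * a) ≤ 2 * γ) (hγ : Real.log (1 + a) / 2 ≤ γ) (hδ : δ₀ / T ≤ δ) :
    Real.log (1 / δ) ≤
      (2 * (1 + |Real.log a| / Real.log (1 + a)) + 2 * |Real.log δ₀| / Real.log (1 + a)) * γ := by
  have hl : 0 < Real.log (1 + a) := Real.log_pos (by linarith)
  have hT0 : 0 < T := by linarith
  have hδ0 : 0 < δ := lt_of_lt_of_le (by positivity) hδ
  have h1 : Real.log (1 / δ) ≤ Real.log T - Real.log δ₀ := by
    rw [← Real.log_div hT0.ne' hδ₀.ne']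
    refine Real.log_le_log (by positivity) ?_
    rw [div_le_div_iff₀ hδ0 hδ₀, one_mul]
    rwa [div_le_iff₀ hT0, mul_comm] at hδ
  have h2 : Real.log T ≤ 2 * γ - Real.log a := by
    have h3 : Real.log (T * a) ≤ Real.log (1 + T * a) :=
      Real.log_le_log (by positivity) (by linarith)
    rw [Real.log_mul hT0.ne' ha.ne'] at h3
    linarith
  have h4 : 1 ≤ 2 * γ / Real.log (1 + a) := by rw [le_div_iff₀ hl]; linarith
  have h5 := le_mul_of_one_le_right (abs_nonneg (Real.log a)) h4
  have h6 := le_mul_of_one_le_right (abs_nonneg (Real.log δ₀)) h4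
  have h7 : (2 * (1 + |Real.log a| / Real.log (1 + a)) +
      2 * |Real.log δ₀| / Real.log (1 + a)) * γ =
      2 * γ + |Real.log a| * (2 * γ / Real.log (1 + a)) +
        |Real.log δ₀| * (2 * γ / Real.log (1 + a)) := by
    ring
  linarith [neg_abs_le (Real.log a), neg_abs_le (Real.log δ₀)]

/-- All rates are monomials in `u = γ^(1/8)` and `q = T^(1/4)`: the restart period is of order
`u² q²` and the target rate is `u⁷ q³`. -/
theorem exists_rate_constants {B G R lam δ₀ κ : ℝ} (hB : 0 < B) (hR : 0 ≤ R)
    (hlam : 0 < lam) (hδ₀ : 0 < δ₀) (hκ : 0 < κ) :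
    ∃ C₁ C₂ : ℝ, 0 < C₁ ∧ 0 < C₂ ∧ ∀ (T W : ℕ) (γ δ : ℝ), 1 ≤ T → 0 < W →
      |(W : ℝ) - γ ^ (1 / 4 : ℝ) * (T : ℝ) ^ (1 / 2 : ℝ)| < 1 →
      Real.log (1 + T * κ / lam) ≤ 2 * γ → γ ≤ T / (2 * lam) → δ₀ / T ≤ δ →
      √(W / lam) * W ≤ C₁ * (γ ^ (7 / 8 : ℝ) * (T : ℝ) ^ (3 / 4 : ℝ)) ∧
      (max B G + 1 / √lam * R * √(2 * Real.log (1 / δ) + 2 * γ)) *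
        √(T * ((lam + 1) * (2 * γ * (T / W + 1)))) ≤
          C₂ * (γ ^ (7 / 8 : ℝ) * (T : ℝ) ^ (3 / 4 : ℝ)) := by
  set a := κ / lam with ha
  have ha0 : 0 < a := by positivity
  set l := Real.log (1 + a) with hl
  have hl0 : 0 < l := Real.log_pos (by linarith)
  -- lower bound for `u`
  set u₀ : ℝ := (l / 2) ^ (1 / 8 : ℝ) with hu₀
  have hu₀0 : 0 < u₀ := by positivity
  -- `W ≤ K u² q²`
  set K : ℝ := 1 + 1 / u₀ ^ 2 with hK
  have hK0 : 0 < K := by positivity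
  -- `u² ≤ M q²`
  set M : ℝ := 1 + 1 / (2 * lam) with hM
  have hM1 : 1 ≤ M := by rw [hM]; linarith [show 0 < 1 / (2 * lam) by positivity]
  -- `log (1 / δ) ≤ L γ`
  set L : ℝ := 2 * (1 + |Real.log a| / l) + 2 * |Real.log δ₀| / l with hL
  have hL0 : 0 < L := by positivity
  have hmax : 0 < max B G := lt_max_of_lt_left hB
  refine ⟨√(K / lam) * K / u₀ ^ 4, (max B G / u₀ ^ 4 + 1 / √lam * R * √(2 * L + 2)) *
    √((lam + 1) * 2 * (2 + M)), by positivity, by positivity, ?_⟩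
  intro T W γ δ hT hW hWγ hlog hγT hδ
  have hT1 : (1 : ℝ) ≤ T := by exact_mod_cast hT
  have hT0 : (0 : ℝ) < T := by linarith
  have hW1 : (1 : ℝ) ≤ W := by exact_mod_cast hW
  have hlT : Real.log (1 + a) ≤ Real.log (1 + T * κ / lam) := by
    refine Real.log_le_log (by positivity) ?_
    rw [mul_div_assoc, ← ha]
    nlinarith
  have hγl : l / 2 ≤ γ := by linarith
  have hγ0 : 0 < γ := by linarith
  set u : ℝ := γ ^ (1 / 8 : ℝ) with hu
  set q : ℝ := (T : ℝ) ^ (1 / 4 : ℝ) with hq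
  have hu0 : 0 < u := by positivity
  have hq1 : 1 ≤ q := Real.one_le_rpow hT1 (by norm_num)
  have hq0 : 0 < q := by linarith
  have huu : u₀ ≤ u := Real.rpow_le_rpow (by positivity) hγl (by norm_num)
  have eγ : γ = u ^ 8 := by rw [hu, ← Real.rpow_natCast, ← Real.rpow_mul hγ0.le]; norm_num
  have eγ4 : γ ^ (1 / 4 : ℝ) = u ^ 2 := by
    rw [hu, ← Real.rpow_natCast, ← Real.rpow_mul hγ0.le]; norm_num
  have eγ7 : γ ^ (7 / 8 : ℝ) = u ^ 7 := by
    rw [hu, ← Real.rpow_natCast, ← Real.rpow_mul hγ0.le]; norm_num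
  have eT : (T : ℝ) = q ^ 4 := by rw [hq, ← Real.rpow_natCast, ← Real.rpow_mul hT0.le]; norm_num
  have eT2 : (T : ℝ) ^ (1 / 2 : ℝ) = q ^ 2 := by
    rw [hq, ← Real.rpow_natCast, ← Real.rpow_mul hT0.le]; norm_num
  have eT3 : (T : ℝ) ^ (3 / 4 : ℝ) = q ^ 3 := by
    rw [hq, ← Real.rpow_natCast, ← Real.rpow_mul hT0.le]; norm_num
  rw [eγ4, eT2, abs_lt] at hWγ
  rw [eγ7, eT3]
  have hu4 : u₀ ^ 4 ≤ u ^ 4 := pow_le_pow_left₀ hu₀0.le huu 4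
  have hWup : (W : ℝ) ≤ K * (u ^ 2 * q ^ 2) := by
    have h1 : 1 ≤ 1 / u₀ ^ 2 * (u ^ 2 * q ^ 2) := by
      rw [one_div_mul_eq_div, le_div_iff₀ (by positivity), one_mul]
      have h2 : u₀ ^ 2 ≤ u ^ 2 := pow_le_pow_left₀ hu₀0.le huu 2
      have h3 : 1 ≤ q ^ 2 := one_le_pow₀ hq1
      nlinarith [sq_nonneg u]
    rw [hK, add_mul, one_mul]
    linarith [hWγ.2]
  have hWlow : u ^ 2 * q ^ 2 / 2 ≤ W := by linarith [hWγ.1]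
  constructor
  · calc √(W / lam) * W ≤ √(K / lam * (u * q) ^ 2) * (K * (u ^ 2 * q ^ 2)) := by
          gcongr
          rw [div_mul_eq_mul_div]
          gcongr
          rw [mul_pow]; exact hWup
      _ = √(K / lam) * K / u₀ ^ 4 * (u ^ 3 * u₀ ^ 4 * q ^ 3) := by
          rw [Real.sqrt_mul' _ (sq_nonneg _), Real.sqrt_sq (by positivity)]
          field_simp
      _ ≤ √(K / lam) * K / u₀ ^ 4 * (u ^ 3 * u ^ 4 * q ^ 3) := by gcongr
      _ = √(K / lam) * K / u₀ ^ 4 * (u ^ 7 * q ^ 3) := by ring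
  · have hu2 : u ^ 2 ≤ M * q ^ 2 := by
      refine le_of_pow_le_pow_left₀ (n := 4) (by norm_num) (by positivity) ?_
      have h1 : 1 / (2 * lam) ≤ M ^ 4 := by
        calc 1 / (2 * lam) ≤ M := by rw [hM]; linarith
          _ ≤ M ^ 4 := le_self_pow₀ hM1 (by norm_num)
      have h2 : q ^ 4 ≤ q ^ 8 := pow_le_pow_right₀ hq1 (by norm_num)
      calc (u ^ 2) ^ 4 = γ := by rw [eγ]; ring
        _ ≤ T / (2 * lam) := hγT
        _ = 1 / (2 * lam) * q ^ 4 := by rw [eT]; ring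
        _ ≤ M ^ 4 * q ^ 8 := by gcongr
        _ = (M * q ^ 2) ^ 4 := by ring
    have hblocks : (T : ℝ) / W + 1 ≤ (2 + M) * q ^ 2 / u ^ 2 := by
      have h1 : (T : ℝ) / W ≤ 2 * q ^ 2 / u ^ 2 := by
        rw [div_le_div_iff₀ (by linarith) (by positivity), eT]
        have := mul_le_mul_of_nonneg_left hWlow (show 0 ≤ 2 * q ^ 2 by positivity)
        linarith
      have h2 : 1 ≤ M * q ^ 2 / u ^ 2 := by rwa [le_div_iff₀ (by positivity), one_mul]
      rw [add_mul, add_div]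
      linarith
    have hsum : √(T * ((lam + 1) * (2 * γ * (T / W + 1)))) ≤
        √((lam + 1) * 2 * (2 + M)) * (u ^ 3 * q ^ 3) := by
      calc √(T * ((lam + 1) * (2 * γ * (T / W + 1))))
          ≤ √(T * ((lam + 1) * (2 * γ * ((2 + M) * q ^ 2 / u ^ 2)))) := by gcongr
        _ = √((lam + 1) * 2 * (2 + M) * (u ^ 3 * q ^ 3) ^ 2) := by
            rw [eT, eγ]; congr 1; field_simp
        _ = _ := by rw [Real.sqrt_mul' _ (sq_nonneg _), Real.sqrt_sq (by positivity)]
    have hlogδ : Real.log (1 / δ) ≤ L * γ := log_inv_le_mul ha0 hδ₀ hT1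
      (by rwa [mul_div_assoc] at hlog) hγl hδ
    have hconf : max B G + 1 / √lam * R * √(2 * Real.log (1 / δ) + 2 * γ) ≤
        (max B G / u₀ ^ 4 + 1 / √lam * R * √(2 * L + 2)) * u ^ 4 := by
      have h1 : max B G ≤ max B G / u₀ ^ 4 * u ^ 4 := by
        rw [div_mul_eq_mul_div, le_div_iff₀ (by positivity)]
        exact mul_le_mul_of_nonneg_left hu4 hmax.le
      have h2 : √(2 * Real.log (1 / δ) + 2 * γ) ≤ √(2 * L + 2) * u ^ 4 := by
        calc √(2 * Real.log (1 / δ) + 2 * γ) ≤ √((2 * L + 2) * (u ^ 4) ^ 2) := by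
              refine Real.sqrt_le_sqrt ?_
              rw [← pow_mul, ← eγ]
              linarith
          _ = _ := by rw [Real.sqrt_mul' _ (sq_nonneg _), Real.sqrt_sq (by positivity)]
      have h3 := mul_le_mul_of_nonneg_left h2 (show 0 ≤ 1 / √lam * R by positivity)
      rw [add_mul, mul_assoc _ _ (u ^ 4)]
      linarith
    calc _ ≤ ((max B G / u₀ ^ 4 + 1 / √lam * R * √(2 * L + 2)) * u ^ 4) *
          (√((lam + 1) * 2 * (2 + M)) * (u ^ 3 * q ^ 3)) :=
          mul_le_mul hconf hsum (Real.sqrt_nonneg _) (by positivity)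
      _ = _ := by ring

/-- The terms of the regret without a factor `ρ` are absorbed by `1 ≤ κ ρ`. -/
theorem regret_rate {C₁ c κ ρ Y Z D D' e : ℝ} (hC₁ : 0 < C₁) (hc : 0 < c) (hκ : 0 < κ)
    (hρ : 0 < ρ) (hκρ : 1 ≤ κ * ρ) (hY : 0 ≤ Y) (hZ : 0 ≤ Z) (hD : D ≤ C₁ * Y)
    (hD' : D' ≤ C₁ * Y) (he : e ≤ 2 * (c * Y)) :
    Z / 2 + (2 * D + ρ * D' + e) ≤ (2 + (2 * C₁ + 2 * c) * (1 + κ)) * (Z + ρ * Y) := by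
  have h1 := mul_le_mul_of_nonneg_left hD' hρ.le
  have h2 : (2 * C₁ + 2 * c) * Y ≤ (2 * C₁ + 2 * c) * κ * (ρ * Y) := by
    have := mul_le_mul_of_nonneg_left hκρ (show 0 ≤ (2 * C₁ + 2 * c) * Y by positivity)
    linarith
  have h4 : 0 ≤ C₁ * (ρ * Y) := by positivity
  have h5 : 0 ≤ c * (ρ * Y) := by positivity
  have h6 : 0 ≤ ρ * Y := by positivity
  have h7 : 0 ≤ (2 * C₁ + 2 * c) * (1 + κ) * Z := by positivity
  linarith

theorem violation_rate {C₁ c κ ρ Y Z D' e : ℝ} (hC₁ : 0 < C₁) (hc : 0 < c) (hκ : 0 < κ)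
    (hρ : 0 < ρ) (hY : 0 ≤ Y) (hZ : 0 ≤ Z) (hD' : D' ≤ C₁ * Y) (he : e ≤ 2 * (c * Y)) :
    2 * Z + (2 * D' + e) ≤ (2 + (2 * C₁ + 2 * c) * (1 + κ)) * ((1 + 1 / ρ) * Y + Z) := by
  have h1 : (2 * C₁ + 2 * c) * Y ≤ (2 + (2 * C₁ + 2 * c) * (1 + κ)) * ((1 + 1 / ρ) * Y) := by
    have h2 : 2 * C₁ + 2 * c ≤ 2 + (2 * C₁ + 2 * c) * (1 + κ) := by
      have : 0 ≤ (2 * C₁ + 2 * c) * κ := by positivity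
      linarith
    have h3 : Y ≤ (1 + 1 / ρ) * Y := le_mul_of_one_le_left hY (by
      linarith [show 0 ≤ 1 / ρ by positivity])
    exact mul_le_mul h2 h3 hY (by positivity)
  have h4 : 0 ≤ (2 * C₁ + 2 * c) * (1 + κ) * Z := by positivity
  linarith

end RestartGPUCB

open RestartGPUCB in
theorem theorem1 (B G R lam τ δ₀ b₀ : ℝ) (hB : 0 < B) (hG : 0 < G) (hR : 0 ≤ R) (hlam : 0 < lam)
    (hτ : 0 < τ) (hδ₀ : 0 < δ₀) (hb₀ : 0 < b₀) :
    ∃ C : ℝ, 0 < C ∧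
      ∀ (X : Type*) [Fintype X]
        (H : Type*) [NormedAddCommGroup H] [InnerProductSpace ℝ H] [CompleteSpace H]
        [RKHS ℝ H X ℝ]
        (H' : Type*) [NormedAddCommGroup H'] [InnerProductSpace ℝ H'] [CompleteSpace H']
        [RKHS ℝ H' X ℝ]
        (T : ℕ) (f : ℕ → H) (g : ℕ → H') (Bf Bg ρ δ γhat : ℝ) (W : ℕ) (πs : ℕ → X → ℝ),
        1 ≤ T →
        -- boundedness
        (∀ x : X, scalarKernel H x x ≤ 1) → (∀ x : X, scalarKernel H' x x ≤ 1) →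
        (∀ t ∈ Finset.Icc 1 T, ‖f t‖ ≤ B) → (∀ t ∈ Finset.Icc 1 T, ‖g t‖ ≤ G) →
        -- Slater condition
        (∀ t ∈ Finset.Icc 1 T, ∃ π ∈ stdSimplex ℝ X, policyMean π (g t) ≤ -τ) →
        -- variation budgets
        ∑ t ∈ Finset.Ico 1 T, ‖f (t + 1) - f t‖ ≤ Bf →
        ∑ t ∈ Finset.Ico 1 T, ‖g (t + 1) - g t‖ ≤ Bg →
        b₀ ≤ max Bf Bg →
        -- best policies
        (∀ t ∈ Finset.Icc 1 T, IsBestPolicy (f t) (g t) (πs t)) →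
        -- parameters of the algorithm
        γhat = max (maxInfoGain (scalarKernel H) lam T) (maxInfoGain (scalarKernel H') lam T) →
        0 < W → |(W : ℝ) - γhat ^ (1 / 4 : ℝ) * (T : ℝ) ^ (1 / 2 : ℝ)| < 1 →
        4 * B / τ ≤ ρ → δ₀ / T ≤ δ → δ < 1 →
        -- probability space, noise, and run of the algorithm
        ∀ (Ω : Type*) (mΩ : MeasurableSpace Ω) (μ : MeasureTheory.Measure Ω)
          [MeasureTheory.IsProbabilityMeasure μ] (ℱ : MeasureTheory.Filtration ℕ mΩ)
          (noise noise' : ℕ → Ω → ℝ) (x : ℕ → Ω → X) (φ : ℕ → Ω → ℝ),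
          (∀ t ∈ Finset.Icc 1 T, Measurable[ℱ t] (noise t) ∧ Measurable[ℱ t] (noise' t)) →
          (∀ t ∈ Finset.Icc 1 T, CondSubGaussian μ (ℱ (t - 1)) R (noise t) ∧
            CondSubGaussian μ (ℱ (t - 1)) R (noise' t)) →
          (∀ t ∈ Finset.Icc 1 T, Measurable[ℱ (t - 1), ⊤] (x t)) →
          (∀ ω : Ω, IsRun (scalarKernel H) (scalarKernel H')
            { lam := lam, delta := δ, R := R, B := B, G := G, rho := ρ, T := T, W := W }
            (fun t => x t ω)
            (fun t => f t (x t ω) + noise t ω) (fun t => g t (x t ω) + noise' t ω)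
            (fun t => φ t ω)) →
          1 - 2 * (⌈(T : ℝ) / W⌉₊ : ℝ) * δ ≤
            μ.real {ω |
              regret (fun t => f t) πs (fun t => x t ω) T ≤
                C * (ρ * G * Real.sqrt T
                  + ρ * γhat ^ (7 / 8 : ℝ) * max Bf Bg * (T : ℝ) ^ (3 / 4 : ℝ)) ∧
              violation (fun t => g t) (fun t => x t ω) T ≤
                C * ((1 + 1 / ρ) * γhat ^ (7 / 8 : ℝ) * max Bf Bg * (T : ℝ) ^ (3 / 4 : ℝ)
                  + G * Real.sqrt T)} := by
  obtain ⟨C₁, C₂, hC₁, hC₂, hrate⟩ :=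
    exists_rate_constants (B := B) (G := G) (R := R) (κ := τ ^ 2 / G ^ 2) hB hR hlam hδ₀
      (by positivity)
  refine ⟨2 + (2 * C₁ + 2 * C₂ / b₀) * (1 + τ / (4 * B)), by positivity, ?_⟩
  intro X _ H _ _ _ _ H' _ _ _ _ T f g Bf Bg ρ δ γhat W πs hT hk hk' hf hg hS hBf hBg hb hπs hγ hW
    hWγ hρ hδ hδ1 Ω mΩ μ _ ℱ noise noise' x φ hnm hsub hxm hrun
  have hT1 : (1 : ℝ) ≤ T := by exact_mod_cast hT
  have hT0 : (0 : ℝ) < T := by linarith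
  have hδ0 : 0 < δ := lt_of_lt_of_le (by positivity) hδ
  have hρ0 : 0 < ρ := lt_of_lt_of_le (by positivity) hρ
  have h1mem : 1 ∈ Finset.Icc 1 T := Finset.mem_Icc.2 ⟨le_rfl, hT⟩
  have hne : Nonempty X := by
    obtain ⟨π, hπ, _⟩ := hS 1 h1mem
    by_contra hemp
    rw [not_nonempty_iff] at hemp
    have := hπ.2
    simp at this
  set p : Params := { lam := lam, delta := δ, R := R, B := B, G := G, rho := ρ, T := T, W := W }
  have hγ1 : maxInfoGain (scalarKernel H) lam T ≤ γhat := hγ ▸ le_max_left _ _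
  have hγ2 : maxInfoGain (scalarKernel H') lam T ≤ γhat := hγ ▸ le_max_right _ _
  have hlog : Real.log (1 + T * (τ ^ 2 / G ^ 2) / lam) ≤ 2 * γhat := by
    obtain ⟨z, hz⟩ := exists_sq_div_sq_le_scalarKernel hG hτ (hg 1 h1mem) (hS 1 h1mem)
    have h1 := log_le_maxInfoGain (scalarKernel H') lam T z
    have h2 : Real.log (1 + T * (τ ^ 2 / G ^ 2) / lam) ≤
        Real.log (1 + T * scalarKernel H' z z / lam) := by
      refine Real.log_le_log (by positivity) ?_
      gcongr
    linarith
  have hγT : γhat ≤ T / (2 * lam) := by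
    rw [hγ]
    exact max_le (maxInfoGain_le hlam hk T) (maxInfoGain_le hlam hk' T)
  obtain ⟨hdrift, hwidth⟩ := hrate T W γhat δ hT hW hWγ hlog hγT hδ
  have hγ0 : 0 ≤ γhat := (maxInfoGain_nonneg hlam T).trans hγ1
  set S : ℝ := γhat ^ (7 / 8 : ℝ) * (T : ℝ) ^ (3 / 4 : ℝ) with hSdef
  have hS0 : 0 ≤ S := by positivity
  set V := max Bf Bg
  have hV0 : 0 < V := hb₀.trans_le hb
  -- outside two events of small probability the noise is controlled at all times
  set E₁ : Set Ω := {ω | ∃ t ∈ Finset.Icc 1 T, ¬ NoiseControlled (scalarKernel H) p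
    (fun t => x t ω) (fun t => noise t ω) t}
  set E₂ : Set Ω := {ω | ∃ t ∈ Finset.Icc 1 T, ¬ NoiseControlled (scalarKernel H') p
    (fun t => x t ω) (fun t => noise' t ω) t}
  have hE {s : Set Ω} (hs : μ s ≤ (⌈(T : ℝ) / W⌉₊ : ENNReal) * ENNReal.ofReal δ) :
      μ.real s ≤ (⌈(T : ℝ) / W⌉₊ : ℝ) * δ := by
    have h1 : (⌈(T : ℝ) / W⌉₊ : ENNReal) * ENNReal.ofReal δ =
        ENNReal.ofReal ((⌈(T : ℝ) / W⌉₊ : ℝ) * δ) := by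
      rw [ENNReal.ofReal_mul (Nat.cast_nonneg _), ENNReal.ofReal_natCast]
    rw [h1] at hs
    exact ENNReal.toReal_le_of_le_ofReal (by positivity) hs
  have hE₁δ : μ.real E₁ ≤ (⌈(T : ℝ) / W⌉₊ : ℝ) * δ :=
    hE (NoiseModel.measure_not_noiseControlled_le (H := H) (ℱ := ℱ) p
      ⟨hxm, fun t ht => (hnm t ht).1, fun t ht => (hsub t ht).1⟩ hR hlam hδ0 hW)
  have hE₂δ : μ.real E₂ ≤ (⌈(T : ℝ) / W⌉₊ : ℝ) * δ :=
    hE (NoiseModel.measure_not_noiseControlled_le (H := H') (ℱ := ℱ) p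
      ⟨hxm, fun t ht => (hnm t ht).2, fun t ht => (hsub t ht).2⟩ hR hlam hδ0 hW)
  have hcover {A : Set Ω} (hA : ∀ ω, ω ∉ E₁ → ω ∉ E₂ → ω ∈ A) :
      1 - 2 * (⌈(T : ℝ) / W⌉₊ : ℝ) * δ ≤ μ.real A := by
    have h1 : (1 : ℝ) ≤ μ.real (A ∪ (E₁ ∪ E₂)) := by
      rw [← probReal_univ (μ := μ)]
      refine measureReal_mono fun ω _ => ?_
      by_cases h1 : ω ∈ E₁
      · exact Or.inr (Or.inl h1)
      · by_cases h2 : ω ∈ E₂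
        · exact Or.inr (Or.inr h2)
        · exact Or.inl (hA ω h1 h2)
    have h2 := measureReal_union_le (μ := μ) A (E₁ ∪ E₂)
    have h3 := measureReal_union_le (μ := μ) E₁ E₂
    linarith
  refine hcover fun ω hω₁ hω₂ => ?_
  have hn₁ : ∀ t ∈ Finset.Icc 1 T, NoiseControlled (scalarKernel H) p (fun t => x t ω)
      (fun t => noise t ω) t := fun t ht => by_contra fun hc => hω₁ ⟨t, ht, hc⟩
  have hn₂ : ∀ t ∈ Finset.Icc 1 T, NoiseControlled (scalarKernel H') p (fun t => x t ω)
      (fun t => noise' t ω) t := fun t ht => by_contra fun hc => hω₂ ⟨t, ht, hc⟩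
  have hopt := optimisticRun (p := p) hlam hR hW hB hG hρ0 hT hk hk' hf hg hn₁ hn₂ (hrun ω)
  have hBfV : Bf ≤ V := le_max_left _ _
  have hBgV : Bg ≤ V := le_max_right _ _
  have hD {V' : ℝ} (hV' : V' ≤ V) : √(W / lam) * W * V' ≤ C₁ * (S * V) := by
    calc √(W / lam) * W * V' ≤ √(W / lam) * W * V := by gcongr
      _ ≤ C₁ * S * V := by gcongr
      _ = C₁ * (S * V) := by ring
  have hDf := (sum_driftError_le (p := p) hW f hBf).trans (hD hBfV)
  have hDg := (sum_driftError_le (p := p) hW g hBg).trans (hD hBgV)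
  -- the lower bound on the variation budget absorbs the width terms
  have hSV : C₂ * S ≤ C₂ / b₀ * (S * V) := by
    rw [div_mul_eq_mul_div, le_div_iff₀ hb₀, mul_assoc]
    gcongr
  have hef := (sum_queryWidth_le (p := p) hlam hR hk hT hB.le (le_max_left B G) hγ1
    (fun t => x t ω)).trans (mul_le_mul_of_nonneg_left (hwidth.trans hSV) zero_le_two)
  have heg := (sum_queryWidth_le (p := p) hlam hR hk' hT hG.le (le_max_right B G) hγ2
    (fun t => x t ω)).trans (mul_le_mul_of_nonneg_left (hwidth.trans hSV) zero_le_two)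
  have hSV0 : 0 ≤ S * V := by positivity
  have hZ : 0 ≤ G * √T := by positivity
  have hκρ : 1 ≤ τ / (4 * B) * ρ := by
    have := (div_le_iff₀ hτ).1 hρ
    rw [div_mul_eq_mul_div, le_div_iff₀ (by positivity)]
    linarith
  refine ⟨?_, ?_⟩
  · have hreg := hopt.regret_le (πs := πs) (fun t ht => (hπs t ht).2.1) fun t ht => (hπs t ht).2.2
    rw [Finset.sum_add_distrib, Finset.sum_add_distrib, ← Finset.mul_sum, ← Finset.mul_sum] at hreg
    rw [mul_div_assoc,
      show ρ * γhat ^ (7 / 8 : ℝ) * V * (T : ℝ) ^ (3 / 4 : ℝ) = ρ * (S * V) by rw [hSdef]; ring]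
    exact hreg.trans (regret_rate hC₁ (by positivity) (by positivity) hρ0 hκρ hSV0
      (by positivity) hDf hDg hef)
  · have hvio := hopt.violation_le hτ hρ hS
      (fun t ht z => (le_abs_self _).trans ((abs_apply_le (g t) z (hk' z)).trans (hg t ht)))
      fun t _ => queryWidth_nonneg _ hR hG.le _ t
    rw [Finset.sum_add_distrib, ← Finset.mul_sum] at hvio
    rw [mul_div_assoc, show (1 + 1 / ρ) * γhat ^ (7 / 8 : ℝ) * V * (T : ℝ) ^ (3 / 4 : ℝ) =
      (1 + 1 / ρ) * (S * V) by rw [hSdef]; ring]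
    exact hvio.trans (violation_rate hC₁ (by positivity) (by positivity) hρ0 hSV0 hZ hDg heg)
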